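/- Let $P_1,\dots,P_n$ be mutually independent random variables and let $\mathcal A$ be a finite nonempty family of events ("bad events"), each determined by $P_1,\dots,P_n$. Let $\mathrm{vbl}(A)$ be the smallest set of variables that determines $A$, and let $\Gamma(A)$ be the set of all $B\in\mathcal A$, $B\ne A$, with $\mathrm{vbl}(A)\cap\mathrm{vbl}(B)\neq\emptyset$. The Moser–Tardos (MT) algorithm starts from an independent random sample of all variables and, while some bad event holds, selects a currently true $A\in\mathcal A$ by an arbitrary (adaptive, possibly randomized) rule that sees only the past, and resamples the variables in $\mathrm{vbl}(A)$ independently from their distributions. There is an absolute constant $K>0$ such that the following holds for all such $P_1,\dots,P_n$, $\mathcal A$ and selection rules. Suppose that there are $\varepsilon\in[0,1)$ and $x:\mathcal A\to(0,1)$ with $$\forall A\in\mathcal A:\quad \Pr[A]\le(1-\varepsilon)\,x(A)\prod_{B\in\Gamma(A)}(1-x(B)),$$ and put $\delta=\min_{A\in\mathcal A}x(A)\prod_{B\in\Gamma(A)}(1-x(B))$ and $T=\sum_{A\in\mathcal A}x(A)$. If $\delta\le\frac14$ (which is automatic as soon as two events of $\mathcal A$ share a variable) and every $A\in\mathcal A$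 depends on at least one variable, then $$T\le n\log_2(1/\delta).$$ Furthermore (without these two provisos): 1. If $\varepsilon=0$, then the expected number of resamplings done by the MT algorithm is at most $v_1=T\max_{A\in\mathcal A}\frac1{1-x(A)}$, and for every $\lambda\ge1$ the algorithm terminates within $\lambda v_1$ resamplings with probability at least $1-1/\lambda$. 2. If $\varepsilon>0$, then the expected number of resamplings done by the MT algorithm is at most $v_2=K\,\frac n\varepsilon\max\{1,\log_2\frac T\varepsilon\}$ (so $v_2=K\,\frac n\varepsilon\log_2\frac T\varepsilon$ when $T\ge2\varepsilon$), and for every $\lambda\ge1$ the algorithm terminates within $\lambda v_2$ resamplings with probability at least $1-\exp(-\lambda)$. -/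

import Mathlib

open MeasureTheory
open scoped ENNReal

universe u v w z

noncomputable section

/-- `vbl B`: the smallest set of variables (coordinates) that determines the event `B`. An event is
a set of assignments `ω : ∀ i, Ω i` of values to the variables, and `S` determines `B` when membership
in `B` depends only on the coordinates in `S`. See `isLeast_vbl`. -/
def vbl {I : Type u} {Ω : I → Type v} (B : Set (∀ i, Ω i)) : Set I :=
  ⋂₀ {S : Set I | DependsOn (fun ω => ω ∈ B) S}

/-- With finitely many variables, `vbl B` itself determines `B`, so it is the least such set. -/
theorem isLeast_vbl {I : Type u} [Finite I] {Ω : I → Type v} (B : Set (∀ i, Ω i)) :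
    IsLeast {S : Set I | DependsOn (fun ω => ω ∈ B) S} (vbl B) := by
  classical
  refine ⟨?_, fun S hS => Set.sInter_subset_of_mem hS⟩
  have hinter : ∀ S T : Set I, DependsOn (fun ω => ω ∈ B) S → DependsOn (fun ω => ω ∈ B) T →
      DependsOn (fun ω => ω ∈ B) (S ∩ T) := by
    intro S T hS hT ω ω' h
    have h1 : (ω ∈ B) = (S.piecewise ω ω' ∈ B) :=
      hS (fun i hi => (Set.piecewise_eq_of_mem S ω ω' hi).symm)
    have h2 : (S.piecewise ω ω' ∈ B) = (ω' ∈ B) := by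
      refine hT (fun i hi => ?_)
      by_cases hiS : i ∈ S
      · rw [Set.piecewise_eq_of_mem S ω ω' hiS]
        exact h i ⟨hiS, hi⟩
      · exact Set.piecewise_eq_of_notMem S ω ω' hiS
    exact h1.trans h2
  have hfin : ∀ F : Set (Set I), F.Finite → F ⊆ {S | DependsOn (fun ω => ω ∈ B) S} →
      DependsOn (fun ω => ω ∈ B) (⋂₀ F) := by
    intro F hF
    induction F, hF using Set.Finite.induction_on with
    | empty =>
      intro _ ω ω' h
      have : ω = ω' := funext fun i => h i (by simp)
      rw [this]
    | insert _ _ ih =>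
      intro hsub
      rw [Set.sInter_insert]
      exact hinter _ _ (hsub (Set.mem_insert _ _))
        (ih fun S hS => hsub (Set.mem_insert_of_mem _ hS))
  exact hfin _ (Set.toFinite _) (fun _ h => h)

open Classical in
/-- The neighbourhood `Γ(a)`: the other bad events that share a variable with the bad event `a`. -/
def nbhd {I : Type u} {Ω : I → Type v} {α : Type w} [Fintype α] (A : α → Set (∀ i, Ω i)) (a : α) :
    Finset α :=
  Finset.univ.filter fun b => b ≠ a ∧ (vbl (A b) ∩ vbl (A a)).Nonempty

/-- `x(a) ∏_{b ∈ Γ(a)} (1 - x(b))`, the right-hand side of the local lemma condition. -/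
def lllWeight {I : Type u} {Ω : I → Type v} {α : Type w} [Fintype α]
    (A : α → Set (∀ i, Ω i)) (x : α → ℝ) (a : α) : ℝ :=
  x a * ∏ b ∈ nbhd A a, (1 - x b)

/-- `δ = min_a x(a) ∏_{b ∈ Γ(a)} (1 - x(b))`. -/
def lllDelta {I : Type u} {Ω : I → Type v} {α : Type w} [Fintype α] [Nonempty α]
    (A : α → Set (∀ i, Ω i)) (x : α → ℝ) : ℝ :=
  Finset.univ.inf' Finset.univ_nonempty (lllWeight A x)

/-- A rule by which the Moser-Tardos algorithm picks a currently true bad event. In round `t` it may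
look at the whole history `h 0, …, h t` of assignments (`h (Fin.last t)` is the current one) and at a
random seed `r : R`; so it is an arbitrary adaptive, possibly randomized, rule. Its value is
irrelevant when no bad event holds. -/
structure SelectionRule {I : Type u} {Ω : I → Type v} [∀ i, MeasurableSpace (Ω i)] {α : Type w}
    (A : α → Set (∀ i, Ω i)) (R : Type z) [MeasurableSpace R] where
  select : R → (t : ℕ) → (Fin (t + 1) → ∀ i, Ω i) → α
  measurableSet_select : ∀ (t : ℕ) (a : α),
    MeasurableSet {p : R × (Fin (t + 1) → ∀ i, Ω i) | select p.1 t p.2 = a}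
  select_mem : ∀ (r : R) (t : ℕ) (h : Fin (t + 1) → ∀ i, Ω i),
    (∃ a, h (Fin.last t) ∈ A a) → h (Fin.last t) ∈ A (select r t h)

open Classical in
/-- The assignments `h 0, …, h t` of the first rounds of the Moser-Tardos algorithm with seed `r` and
fresh samples `y 0, y 1, …`. The initial assignment is `y 0`. While a bad event holds, one is selected
and exactly its variables are replaced by their values in the next fresh sample; once no bad event
holds the algorithm has stopped and the assignment stays as it is. -/
def mtHistory {I : Type u} {Ω : I → Type v} [∀ i, MeasurableSpace (Ω i)] {α : Type w}
    {A : α → Set (∀ i, Ω i)} {R : Type z} [MeasurableSpace R] (σ : SelectionRule A R)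
    (r : R) (y : ℕ → ∀ i, Ω i) : (t : ℕ) → Fin (t + 1) → ∀ i, Ω i
  | 0 => fun _ => y 0
  | t + 1 =>
    let h := mtHistory σ r y t
    Fin.snoc (α := fun _ => ∀ i, Ω i) h
      (if ∃ a, h (Fin.last t) ∈ A a then
        (vbl (A (σ.select r t h))).piecewise (y (t + 1)) (h (Fin.last t))
      else h (Fin.last t))

/-- The assignment held by the Moser-Tardos algorithm after `t` rounds. -/
def mtState {I : Type u} {Ω : I → Type v} [∀ i, MeasurableSpace (Ω i)] {α : Type w}
    {A : α → Set (∀ i, Ω i)} {R : Type z} [MeasurableSpace R] (σ : SelectionRule A R)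
    (r : R) (y : ℕ → ∀ i, Ω i) (t : ℕ) : ∀ i, Ω i :=
  mtHistory σ r y t (Fin.last t)

/-- The total number of resamplings done by the Moser-Tardos algorithm: the number of rounds in which
some bad event holds. It is `⊤` exactly when the algorithm never terminates. -/
def mtResamplings {I : Type u} {Ω : I → Type v} [∀ i, MeasurableSpace (Ω i)] {α : Type w}
    {A : α → Set (∀ i, Ω i)} {R : Type z} [MeasurableSpace R] (σ : SelectionRule A R)
    (p : R × (ℕ → ∀ i, Ω i)) : ℕ∞ :=
  Set.encard {t : ℕ | ∃ a, mtState σ p.1 p.2 t ∈ A a}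

/-- The law of the randomness used by the Moser-Tardos algorithm: a seed with law `ρ` and independent
samples `y 0, y 1, …` of all the variables, each with the product law `Measure.pi μ`. -/
def mtMeasure {I : Type u} [Fintype I] {Ω : I → Type v} [∀ i, MeasurableSpace (Ω i)]
    (μ : ∀ i, Measure (Ω i)) [∀ i, IsProbabilityMeasure (μ i)] {R : Type z} [MeasurableSpace R]
    (ρ : Measure R) : Measure (R × (ℕ → ∀ i, Ω i)) :=
  ρ.prod (Measure.infinitePi fun _ : ℕ => Measure.pi μ)

end

/-! Every resampling is charged to a witness: a list of levels, deepest level first, with the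
resampled event as root. It collects, backwards in time, the earlier resamplings that share a
variable with something already collected. Three facts carry the proof.

Probability: the expected number of rounds with witness `τ` is at most the product of the
probabilities of the events in `τ` (`lintegral_logWitness_le`). The run is analysed by its first
round. If `f` is resampled first, the witness of a later round is `insertEvent f` of its witness in
the remaining run. This map is injective on witnesses (`insertEvent_injOn`), and resampling a true
`f` before testing `τ` succeeds no more often than testing `insertEvent f τ`
(`resample_witnessProb_le`).

Counting: if `w a * ∏ (1 + ψ b) ≤ ψ a`, with the product over the closed neighbourhood of `a`, then
the total `w`-weight of all witnesses is at most `∑ ψ` (`sum_levelsWeight_le`, a telescoping sum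
over the depth). The local lemma condition is this hypothesis for `ψ = x / (1 - x)`, which gives the
case `ε = 0`.

Slack: for `ε > 0` the condition survives multiplying each probability by some `z > 1`, so witnesses
can be counted with weight `z ^ size`. A run longer than `m` rounds resamples some variable more
than `m / n` times, and the last such round has a witness of at least that size. Hence the
probability of reaching round `m` decays like `(T / ε) * exp (-ε m / (2 n))` up to a constant
factor.

The bound on `T` is separate: the events that involve a fixed variable are pairwise adjacent, which
forces their total weight to be at most `log₂ (1 / δ)`. -/

/-! ### Resampling a set of coordinates of a product measure -/

section Resampling

open scoped Classical

variable {I : Type u} {Ω : I → Type v}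

theorem dependsOn_indicator {B : Set (∀ i, Ω i)} {T : Set I}
    (hB : DependsOn (fun ω => ω ∈ B) T) :
    DependsOn (B.indicator (1 : (∀ i, Ω i) → ℝ≥0∞)) T := by
  intro ω ω' h
  have := hB h
  simp only at this
  simp [Set.indicator, this]

variable [∀ i, MeasurableSpace (Ω i)]

theorem measurable_piecewise_prod (S : Set I) :
    Measurable fun p : (∀ i, Ω i) × (∀ i, Ω i) => S.piecewise p.1 p.2 := by
  refine measurable_pi_lambda _ fun i => ?_
  by_cases hi : i ∈ S
  · simp only [Set.piecewise, hi, if_true]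
    exact (measurable_pi_apply (X := Ω) i).comp measurable_fst
  · simp only [Set.piecewise, hi, if_false]
    exact (measurable_pi_apply (X := Ω) i).comp measurable_snd

variable [Fintype I] (μ : ∀ i, Measure (Ω i))

/-- The mean of `g` after the coordinates in `S` have been resampled. -/
noncomputable def resample (S : Set I) (g : (∀ i, Ω i) → ℝ≥0∞) (ω : ∀ i, Ω i) : ℝ≥0∞ :=
  ∫⁻ y, g (S.piecewise y ω) ∂Measure.pi μ

theorem resample_mono (S : Set I) {g g' : (∀ i, Ω i) → ℝ≥0∞} {ω : ∀ i, Ω i}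
    (h : ∀ y : ∀ i, Ω i, g (S.piecewise y ω) ≤ g' (S.piecewise y ω)) :
    resample μ S g ω ≤ resample μ S g' ω :=
  lintegral_mono h

theorem resample_indicator_mul {B : Set (∀ i, Ω i)} {S T : Set I}
    (hB : DependsOn (fun ω => ω ∈ B) T) (h : Disjoint T S) (g : (∀ i, Ω i) → ℝ≥0∞)
    (ω : ∀ i, Ω i) :
    resample μ S (fun ω => B.indicator 1 ω * g ω) ω = B.indicator 1 ω * resample μ S g ω := by
  have : ∀ y : ∀ i, Ω i, B.indicator (1 : (∀ i, Ω i) → ℝ≥0∞) (S.piecewise y ω) =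
      B.indicator 1 ω := fun y =>
    dependsOn_indicator hB fun i hi =>
      Set.piecewise_eq_of_notMem S _ _ (Set.disjoint_left.1 h hi)
  simp only [resample, this]
  exact lintegral_const_mul' _ _ (by by_cases hω : ω ∈ B <;> simp [hω])

variable [∀ i, IsProbabilityMeasure (μ i)]

/-- Exchanging the coordinates in `S` between two independent samples preserves their joint law. -/
theorem measurePreserving_piecewise_swap (S : Set I) :
    MeasurePreserving
      (fun p : (∀ i, Ω i) × (∀ i, Ω i) => (S.piecewise p.1 p.2, S.piecewise p.2 p.1))
      ((Measure.pi μ).prod (Measure.pi μ)) ((Measure.pi μ).prod (Measure.pi μ)) := by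
  have hm : Measurable
      (fun p : (∀ i, Ω i) × (∀ i, Ω i) => (S.piecewise p.1 p.2, S.piecewise p.2 p.1)) :=
    (measurable_piecewise_prod S).prodMk ((measurable_piecewise_prod S).comp measurable_swap)
  refine ⟨hm, ?_⟩
  have huniv : (Set.univ : Set (∀ i, Ω i)) ∈
      Set.pi Set.univ '' Set.pi Set.univ fun i => {s : Set (Ω i) | MeasurableSet s} :=
    ⟨fun _ => Set.univ, fun i _ => MeasurableSet.univ, Set.pi_univ _⟩
  have hspan : (Measure.pi μ).FiniteSpanningSetsIn
      (Set.pi Set.univ '' Set.pi Set.univ fun i => {s : Set (Ω i) | MeasurableSet s}) :=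
    ⟨fun _ => Set.univ, fun _ => huniv, fun _ => by simp, Set.iUnion_const _⟩
  symm
  refine Measure.prod_eq_generateFrom generateFrom_pi generateFrom_pi isPiSystem_pi isPiSystem_pi
    hspan hspan ?_
  rintro _ ⟨s, hs, rfl⟩ _ ⟨t, ht, rfl⟩
  have hs' : MeasurableSet (Set.pi Set.univ s) :=
    MeasurableSet.univ_pi fun i => hs i (Set.mem_univ i)
  have ht' : MeasurableSet (Set.pi Set.univ t) :=
    MeasurableSet.univ_pi fun i => ht i (Set.mem_univ i)
  rw [Measure.map_apply hm (hs'.prod ht')]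
  have hpre : (fun p : (∀ i, Ω i) × (∀ i, Ω i) => (S.piecewise p.1 p.2, S.piecewise p.2 p.1)) ⁻¹'
      (Set.pi Set.univ s ×ˢ Set.pi Set.univ t) =
      Set.pi Set.univ (S.piecewise s t) ×ˢ Set.pi Set.univ (S.piecewise t s) := by
    ext p
    simp only [Set.mem_preimage, Set.mem_prod, Set.mem_univ_pi, ← forall_and]
    refine forall_congr' fun i => ?_
    by_cases hi : i ∈ S
    · simp [hi]
    · simp [hi, and_comm]
  rw [hpre, Measure.prod_prod, Measure.pi_pi, Measure.pi_pi, Measure.pi_pi, Measure.pi_pi,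
    ← Finset.prod_mul_distrib, ← Finset.prod_mul_distrib]
  refine Finset.prod_congr rfl fun i _ => ?_
  by_cases hi : i ∈ S
  · simp [hi]
  · simp [hi, mul_comm]

theorem measurePreserving_piecewise (S : Set I) :
    MeasurePreserving (fun p : (∀ i, Ω i) × (∀ i, Ω i) => S.piecewise p.1 p.2)
      ((Measure.pi μ).prod (Measure.pi μ)) (Measure.pi μ) :=
  measurePreserving_fst.comp (measurePreserving_piecewise_swap μ S)

theorem measurable_resample (S : Set I) {g : (∀ i, Ω i) → ℝ≥0∞} (hg : Measurable g) :
    Measurable (resample μ S g) :=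
  Measurable.lintegral_prod_left' (hg.comp (measurable_piecewise_prod S))

theorem resample_of_dependsOn {S T : Set I} {g : (∀ i, Ω i) → ℝ≥0∞} (hg : DependsOn g T)
    (h : Disjoint T S) : resample μ S g = g := by
  funext ω
  have : ∀ y : ∀ i, Ω i, g (S.piecewise y ω) = g ω := fun y =>
    hg fun i hi => Set.piecewise_eq_of_notMem S _ _ (Set.disjoint_left.1 h hi)
  simp [resample, this]

theorem resample_resample (S T : Set I) {g : (∀ i, Ω i) → ℝ≥0∞} (hg : Measurable g) :
    resample μ S (resample μ T g) = resample μ (S ∪ T) g := by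
  obtain ⟨U, hU⟩ : ∃ U, U = S ∪ T := ⟨_, rfl⟩
  rw [← hU]
  funext ω
  have hg' : Measurable fun y : ∀ i, Ω i => g (U.piecewise y ω) :=
    hg.comp ((measurable_piecewise_prod U).comp (measurable_id.prodMk (measurable_const (a := ω))))
  simp only [resample]
  -- One fresh sample has the law of a mixture of two: coordinates in `T` from the later resampling,
  -- the others from the earlier one.
  rw [← (measurePreserving_piecewise μ T).lintegral_comp hg']
  refine Eq.trans ?_ (lintegral_prod_symm' _ (hg'.comp (measurable_piecewise_prod T))).symm
  refine lintegral_congr fun y => lintegral_congr fun y' => congrArg g ?_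
  funext i
  by_cases hT : i ∈ T <;> by_cases hS : i ∈ S <;> simp [Set.piecewise, hU, hT, hS]

/-- An event determined by the variables in `S` is independent of everything seen after these
variables have been resampled. -/
theorem lintegral_indicator_mul_resample {B : Set (∀ i, Ω i)} (hBm : MeasurableSet B) {S : Set I}
    (hB : DependsOn (fun ω => ω ∈ B) S) {g : (∀ i, Ω i) → ℝ≥0∞} (hg : Measurable g) :
    ∫⁻ ω, B.indicator 1 ω * resample μ S g ω ∂Measure.pi μ =
      Measure.pi μ B * ∫⁻ ω, g ω ∂Measure.pi μ := by
  have h1 : Measurable (B.indicator (1 : (∀ i, Ω i) → ℝ≥0∞)) := measurable_one.indicator hBm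
  have hF : Measurable fun p : (∀ i, Ω i) × (∀ i, Ω i) =>
      B.indicator (1 : (∀ i, Ω i) → ℝ≥0∞) p.2 * g p.1 :=
    (h1.comp measurable_snd).mul (hg.comp measurable_fst)
  have hprod := lintegral_prod_mul (μ := Measure.pi μ) (ν := Measure.pi μ) hg.aemeasurable
    h1.aemeasurable
  rw [lintegral_indicator_one hBm, mul_comm] at hprod
  rw [← hprod]
  simp only [mul_comm (g _)]
  -- After the swap `B` reads its coordinates, all in `S`, from `ω`, while `g` sees fresh values on
  -- `S` and `ω` elsewhere.
  rw [← (measurePreserving_piecewise_swap μ S).lintegral_comp hF]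
  refine Eq.trans ?_ (lintegral_prod_symm' _
    (hF.comp (measurePreserving_piecewise_swap μ S).measurable)).symm
  refine lintegral_congr fun ω => ?_
  have : ∀ y : ∀ i, Ω i, B.indicator (1 : (∀ i, Ω i) → ℝ≥0∞) (S.piecewise ω y) =
      B.indicator 1 ω := fun y =>
    dependsOn_indicator hB fun i hi => Set.piecewise_eq_of_mem S _ _ hi
  simp only [Function.comp_apply, this, resample]
  exact (lintegral_const_mul' _ _ (by by_cases hω : ω ∈ B <;> simp [hω])).symm

end Resampling

/-! ### Witnesses of resamplings -/

section Witness

open scoped Classical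

variable {I : Type u} {α : Type w} (V : α → Set I)

/-- The variables of the events in a level. -/
def levelVars (J : Finset α) : Set I := ⋃ a ∈ J, V a

theorem disjoint_levelVars_left {J : Finset α} {S : Set I} :
    Disjoint (levelVars V J) S ↔ ∀ a ∈ J, Disjoint (V a) S := by
  simp [levelVars, Set.disjoint_iUnion_left]

theorem levelVars_insert (a : α) (J : Finset α) :
    levelVars V (insert a J) = V a ∪ levelVars V J := by
  simp [levelVars]

theorem levelVars_singleton (a : α) : levelVars V {a} = V a := by
  simp [levelVars]

/-- `f` shares a variable with some event of the list of levels. -/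
def Meets (f : α) (τ : List (Finset α)) : Prop := ∃ J ∈ τ, ¬Disjoint (V f) (levelVars V J)

theorem meets_cons {f : α} {J : Finset α} {τ : List (Finset α)} :
    Meets V f (J :: τ) ↔ ¬Disjoint (V f) (levelVars V J) ∨ Meets V f τ := by
  simp [Meets]

/-- Put `f` into a list of levels (the root level comes last) just below the deepest level that
shares a variable with `f`; the list is left unchanged if there is no such level. -/
noncomputable def insertEvent (f : α) : List (Finset α) → List (Finset α)
  | [] => []
  | [J] => if Disjoint (V f) (levelVars V J) then [J] else [{f}, J]
  | J :: K :: L =>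
    if Disjoint (V f) (levelVars V J) then
      if Disjoint (V f) (levelVars V K) then J :: insertEvent f (K :: L)
      else insert f J :: K :: L
    else {f} :: J :: K :: L

/-- Witnesses: lists of nonempty levels of pairwise disjoint events, the last of which is a singleton,
such that every event shares a variable with the next level. -/
def IsWitness : List (Finset α) → Prop
  | [] => False
  | [J] => ∃ a, J = {a}
  | J :: K :: L => J.Nonempty ∧ (∀ a ∈ J, ¬Disjoint (V a) (levelVars V K)) ∧
      (J : Set α).PairwiseDisjoint V ∧ IsWitness (K :: L)

variable {V}

theorem IsWitness.ne_nil {τ : List (Finset α)} (h : IsWitness V τ) : τ ≠ [] := by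
  rintro rfl
  exact h

theorem IsWitness.head_nonempty {J : Finset α} {L : List (Finset α)} (h : IsWitness V (J :: L)) :
    J.Nonempty := by
  cases L with
  | nil => obtain ⟨a, rfl⟩ := h; simp
  | cons K L => exact h.1

theorem IsWitness.head_pairwiseDisjoint {J : Finset α} {L : List (Finset α)}
    (h : IsWitness V (J :: L)) : (J : Set α).PairwiseDisjoint V := by
  cases L with
  | nil => obtain ⟨a, rfl⟩ := h; simp
  | cons K L => exact h.2.2.1

theorem insertEvent_of_not_meets {f : α} : ∀ {τ : List (Finset α)}, ¬Meets V f τ →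
    insertEvent V f τ = τ
  | [], _ => by simp [insertEvent]
  | [J], h => by
    simp only [meets_cons, not_or, not_not] at h
    simp [insertEvent, h.1]
  | J :: K :: L, h => by
    have h' := h
    simp only [meets_cons, not_or, not_not] at h'
    have : ¬Meets V f (K :: L) := fun hm => h ((meets_cons V).2 (Or.inr hm))
    simp [insertEvent, h'.1, h'.2.1, insertEvent_of_not_meets this]

theorem meets_insertEvent {f : α} : ∀ {τ : List (Finset α)}, Meets V f τ →
    Meets V f (insertEvent V f τ)
  | [], h => by simp [Meets] at h
  | [J], h => by
    by_cases hJ : Disjoint (V f) (levelVars V J)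
    · simpa [insertEvent, hJ] using h
    · simp [insertEvent, hJ, meets_cons]
  | J :: K :: L, h => by
    by_cases hJ : Disjoint (V f) (levelVars V J)
    · by_cases hK : Disjoint (V f) (levelVars V K)
      · have : Meets V f (K :: L) := by
          rw [meets_cons] at h
          exact h.resolve_left (not_not.2 hJ)
        have := meets_insertEvent this
        simp only [insertEvent, hJ, hK, if_true]
        exact (meets_cons V).2 (Or.inr this)
      · simp [insertEvent, hJ, hK, meets_cons]
    · simp [insertEvent, hJ, meets_cons]

theorem isWitness_insertEvent (f : α) : ∀ {τ : List (Finset α)}, IsWitness V τ →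
    IsWitness V (insertEvent V f τ)
  | [], h => h.elim
  | [J], h => by
    by_cases hJ : Disjoint (V f) (levelVars V J)
    · simpa [insertEvent, hJ] using h
    · simp only [insertEvent, hJ, if_false]
      exact ⟨by simp, by simpa using hJ, by simp, h⟩
  | J :: K :: L, h => by
    by_cases hJ : Disjoint (V f) (levelVars V J)
    · by_cases hK : Disjoint (V f) (levelVars V K)
      · simp only [insertEvent, hJ, hK, if_true]
        obtain ⟨h1, h2, h3, h4⟩ := h
        have h5 := isWitness_insertEvent f h4
        cases L with
        | nil =>
          simp only [insertEvent, hK, if_true] at h5 ⊢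
          exact ⟨h1, h2, h3, h5⟩
        | cons K' L =>
          by_cases hK' : Disjoint (V f) (levelVars V K')
          · simp only [insertEvent, hK, hK', if_true] at h5 ⊢
            exact ⟨h1, h2, h3, h5⟩
          · simp only [insertEvent, hK, hK', if_true, if_false] at h5 ⊢
            -- The level `K` only grows, so the events of `J` still meet it.
            refine ⟨h1, fun a ha hd => h2 a ha ?_, h3, h5⟩
            rw [levelVars_insert] at hd
            exact hd.mono_right Set.subset_union_right
      · simp only [insertEvent, hJ, hK, if_true, if_false]
        obtain ⟨h1, h2, h3, h4⟩ := h
        refine ⟨by simp, ?_, ?_, h4⟩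
        · simpa [hK] using h2
        · rw [Finset.coe_insert]
          refine h3.insert fun a ha _ => ?_
          exact ((disjoint_levelVars_left V).1 hJ.symm a ha).symm
    · simp only [insertEvent, hJ, if_false]
      exact ⟨by simp, by simpa using hJ, by simp, h⟩

/-- Remove the deepest occurrence of `f` from a list of levels. -/
noncomputable def removeEvent (f : α) : List (Finset α) → List (Finset α)
  | [] => []
  | J :: L => if f ∈ J then (if J = {f} then L else J.erase f :: L) else J :: removeEvent f L

theorem notMem_of_disjoint {f : α} (hf : (V f).Nonempty) {J : Finset α}
    (hJ : Disjoint (V f) (levelVars V J)) : f ∉ J := fun h => by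
  have := (disjoint_levelVars_left V).1 hJ.symm f h
  rw [disjoint_self] at this
  exact hf.ne_empty this

/-- Levels deeper than the one that receives `f` are disjoint from `V f`, so as `V f` is nonempty
they do not contain `f`: the inserted copy is the deepest one. Old levels are nonempty, so a level
equal to `{f}` is new and has to be dropped entirely. -/
theorem removeEvent_insertEvent {f : α} (hf : (V f).Nonempty) : ∀ {τ : List (Finset α)},
    IsWitness V τ → Meets V f τ → removeEvent f (insertEvent V f τ) = τ
  | [], h, _ => h.elim
  | [J], h, hm => by
    by_cases hJ : Disjoint (V f) (levelVars V J)
    · simp [Meets, hJ] at hm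
    · simp [insertEvent, hJ, removeEvent]
  | J :: K :: L, h, hm => by
    by_cases hJ : Disjoint (V f) (levelVars V J)
    · have hfJ := notMem_of_disjoint hf hJ
      by_cases hK : Disjoint (V f) (levelVars V K)
      · have : Meets V f (K :: L) := by
          rw [meets_cons] at hm
          exact hm.resolve_left (not_not.2 hJ)
        simp [insertEvent, hJ, hK, removeEvent, hfJ, removeEvent_insertEvent hf h.2.2.2 this]
      · have hne : insert f J ≠ {f} := by
          intro he
          obtain ⟨a, ha⟩ := h.head_nonempty
          have : a ∈ ({f} : Finset α) := he ▸ Finset.mem_insert_of_mem ha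
          rw [Finset.mem_singleton] at this
          exact hfJ (this ▸ ha)
        simp [insertEvent, hJ, hK, removeEvent, hne, Finset.erase_insert hfJ]
    · simp [insertEvent, hJ, removeEvent]

/-- The insertion can be undone when `f` meets the list and does nothing otherwise; since it
preserves whether `f` meets the list, the two cases cannot collide. -/
theorem insertEvent_injOn {f : α} (hf : (V f).Nonempty) {τ τ' : List (Finset α)}
    (hτ : IsWitness V τ) (hτ' : IsWitness V τ') (h : insertEvent V f τ = insertEvent V f τ') :
    τ = τ' := by
  by_cases hm : Meets V f τ <;> by_cases hm' : Meets V f τ'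
  · rw [← removeEvent_insertEvent hf hτ hm, h, removeEvent_insertEvent hf hτ' hm']
  · rw [insertEvent_of_not_meets hm'] at h
    exact absurd (h ▸ meets_insertEvent hm) hm'
  · rw [insertEvent_of_not_meets hm] at h
    exact absurd (h ▸ meets_insertEvent hm') hm
  · rwa [insertEvent_of_not_meets hm, insertEvent_of_not_meets hm'] at h

/-- Separates the first round, whose witness is `[{f}]`, from all later ones. -/
theorem insertEvent_ne_singleton {f : α} (hf : (V f).Nonempty) {τ : List (Finset α)}
    (hτ : IsWitness V τ) : insertEvent V f τ ≠ [{f}] := by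
  intro h
  by_cases hm : Meets V f τ
  · have := removeEvent_insertEvent hf hτ hm
    rw [h] at this
    exact hτ.ne_nil (by simpa [removeEvent] using this.symm)
  · rw [insertEvent_of_not_meets hm] at h
    refine hm ⟨{f}, by simp [h], ?_⟩
    rw [levelVars_singleton, disjoint_self]
    exact hf.ne_empty

/-- The number of events in a list of levels. -/
def levelsCard (τ : List (Finset α)) : ℕ := (τ.map Finset.card).sum

theorem levelsCard_insertEvent {f : α} (hf : (V f).Nonempty) : ∀ {τ : List (Finset α)},
    Meets V f τ → levelsCard (insertEvent V f τ) = levelsCard τ + 1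
  | [], h => by simp [Meets] at h
  | [J], hm => by
    by_cases hJ : Disjoint (V f) (levelVars V J)
    · simp [Meets, hJ] at hm
    · simp [insertEvent, hJ, levelsCard, add_comm]
  | J :: K :: L, hm => by
    by_cases hJ : Disjoint (V f) (levelVars V J)
    · have hfJ := notMem_of_disjoint hf hJ
      by_cases hK : Disjoint (V f) (levelVars V K)
      · have : Meets V f (K :: L) := by
          rw [meets_cons] at hm
          exact hm.resolve_left (not_not.2 hJ)
        have := levelsCard_insertEvent hf this
        simp only [levelsCard, List.map_cons, List.sum_cons, insertEvent, hJ, hK, if_true] at this ⊢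
        omega
      · simp only [levelsCard, List.map_cons, List.sum_cons, insertEvent, hJ, hK, if_true, if_false,
          Finset.card_insert_of_notMem hfJ]
        omega
    · simp [insertEvent, hJ, levelsCard]
      omega

theorem meets_insertEvent_of_meets {f g : α} : ∀ {τ : List (Finset α)}, Meets V g τ →
    Meets V g (insertEvent V f τ)
  | [], h => by simp [Meets] at h
  | [J], h => by
    by_cases hJ : Disjoint (V f) (levelVars V J)
    · simpa [insertEvent, hJ] using h
    · simp only [insertEvent, hJ, if_false]
      exact (meets_cons V).2 (Or.inr h)
  | J :: K :: L, h => by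
    by_cases hJ : Disjoint (V f) (levelVars V J)
    · by_cases hK : Disjoint (V f) (levelVars V K)
      · simp only [insertEvent, hJ, hK, if_true]
        rw [meets_cons] at h ⊢
        exact h.imp_right meets_insertEvent_of_meets
      · simp only [insertEvent, hJ, hK, if_true, if_false]
        rw [meets_cons] at h ⊢
        refine h.imp_left fun h hd => h (hd.mono_right ?_)
        rw [levelVars_insert]
        exact Set.subset_union_right
    · simp only [insertEvent, hJ, if_false]
      exact (meets_cons V).2 (Or.inr h)

variable (V)

/-- The witness of the resampling in round `t` of a run with log `a`, where `a s = none` means that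
the run has stopped before round `s`: it collects, going back in time from round `t`, the events that
share a variable with an event collected before. -/
noncomputable def logWitness : (ℕ → Option α) → ℕ → List (Finset α)
  | a, 0 => (a 0).elim [] fun f => [{f}]
  | a, t + 1 => (a 0).elim [] fun f => insertEvent V f (logWitness (fun s => a (s + 1)) t)

theorem isWitness_logWitness : ∀ (t : ℕ) (a : ℕ → Option α),
    logWitness V a t = [] ∨ IsWitness V (logWitness V a t)
  | 0, a => by
    cases h : a 0 with
    | none => simp [logWitness, h]
    | some f => exact Or.inr (by simp [logWitness, h, IsWitness])
  | t + 1, a => by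
    cases h : a 0 with
    | none => simp [logWitness, h]
    | some f =>
      simp only [logWitness, h, Option.elim]
      refine (isWitness_logWitness t _).imp (fun h0 => ?_) (isWitness_insertEvent f)
      rw [h0, insertEvent]

theorem length_insertEvent_le (f : α) : ∀ τ : List (Finset α),
    (insertEvent V f τ).length ≤ τ.length + 1
  | [] => by simp [insertEvent]
  | [J] => by
    by_cases hJ : Disjoint (V f) (levelVars V J) <;> simp [insertEvent, hJ]
  | J :: K :: L => by
    have := length_insertEvent_le f (K :: L)
    by_cases hJ : Disjoint (V f) (levelVars V J)
    · by_cases hK : Disjoint (V f) (levelVars V K)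
      · simpa [insertEvent, hJ, hK] using this
      · simp [insertEvent, hJ, hK]
    · simp [insertEvent, hJ]

theorem length_logWitness_le : ∀ (t : ℕ) (a : ℕ → Option α), (logWitness V a t).length ≤ t + 1
  | 0, a => by
    cases h : a 0 <;> simp [logWitness, h]
  | t + 1, a => by
    cases h : a 0 with
    | none => simp [logWitness, h]
    | some f =>
      simp only [logWitness, h, Option.elim]
      exact (length_insertEvent_le V f _).trans (by simpa using length_logWitness_le t _)

theorem logWitness_congr : ∀ {t : ℕ} {a b : ℕ → Option α}, (∀ s ≤ t, a s = b s) →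
    logWitness V a t = logWitness V b t
  | 0, a, b, h => by simp [logWitness, h 0 le_rfl]
  | t + 1, a, b, h => by
    simp only [logWitness, h 0 (Nat.zero_le _)]
    rw [logWitness_congr fun s hs => h (s + 1) (by omega)]

/-- The root `b t` enters first, and insertions never remove anything. -/
theorem meets_logWitness : ∀ {t : ℕ} {b : ℕ → α} {a : ℕ → Option α},
    (∀ s ≤ t, a s = some (b s)) → ∀ {g : α}, ¬Disjoint (V g) (V (b t)) →
      Meets V g (logWitness V a t)
  | 0, b, a, h, g, hg => by
    simpa [logWitness, h 0 le_rfl, Meets, levelVars_singleton] using hg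
  | t + 1, b, a, h, g, hg => by
    simp only [logWitness, h 0 (Nat.zero_le _), Option.elim]
    exact meets_insertEvent_of_meets
      (meets_logWitness (b := fun s => b (s + 1)) (fun s hs => h (s + 1) (by omega)) hg)

/-- The witness of a resampling that involves the variable `i` contains all the previous
resamplings that involve `i`. -/
theorem card_le_levelsCard_logWitness (i : I) : ∀ {t : ℕ} {b : ℕ → α}
    {a : ℕ → Option α}, (∀ s ≤ t, a s = some (b s)) → i ∈ V (b t) →
      ((Finset.range (t + 1)).filter fun s => i ∈ V (b s)).card ≤ levelsCard (logWitness V a t)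
  | 0, b, a, h, hi => by
    exact (Finset.card_filter_le _ _).trans (by simp [logWitness, h 0 le_rfl, levelsCard])
  | t + 1, b, a, h, hi => by
    have hs : ∀ s ≤ t, a (s + 1) = some (b (s + 1)) := fun s hs => h (s + 1) (by omega)
    have ih := card_le_levelsCard_logWitness i hs hi
    have hcard : ((Finset.range (t + 1 + 1)).filter fun s => i ∈ V (b s)).card =
        ((Finset.range (t + 1)).filter fun s => i ∈ V (b (s + 1))).card +
          if i ∈ V (b 0) then 1 else 0 := by
      simp only [Finset.card_filter]
      rw [Finset.sum_range_succ' _ (t + 1)]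
    rw [hcard]
    simp only [logWitness, h 0 (Nat.zero_le _), Option.elim]
    -- If `b 0` involves `i`, it shares `i` with the root and is really inserted; otherwise
    -- inserting it cannot decrease the count.
    by_cases h0 : i ∈ V (b 0)
    · have hm : Meets V (b 0) (logWitness V (fun s => a (s + 1)) t) :=
        meets_logWitness V (b := fun s => b (s + 1)) hs
          (Set.not_disjoint_iff.2 ⟨i, h0, hi⟩)
      rw [levelsCard_insertEvent ⟨i, h0⟩ hm, if_pos h0]
      omega
    · rw [if_neg h0]
      refine ih.trans ?_
      by_cases hm : Meets V (b 0) (logWitness V (fun s => a (s + 1)) t)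
      · by_cases hne : (V (b 0)).Nonempty
        · rw [levelsCard_insertEvent hne hm]
          omega
        · obtain ⟨J, _, hJ⟩ := hm
          rw [Set.not_nonempty_iff_eq_empty.1 hne] at hJ
          simp at hJ
      · rw [insertEvent_of_not_meets hm]

end Witness

/-! ### The probability that a witness passes its test -/

section WitnessProbability

open scoped Classical

variable {I : Type u} {Ω : I → Type v}

theorem dependsOn_vbl [Finite I] (B : Set (∀ i, Ω i)) : DependsOn (fun ω => ω ∈ B) (vbl B) :=
  (isLeast_vbl B).1

variable {α : Type w} (A : α → Set (∀ i, Ω i))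

/-- All the events in `J` hold. -/
def levelEvent (J : Finset α) : Set (∀ i, Ω i) := ⋂ a ∈ J, A a

theorem dependsOn_levelEvent [Finite I] (J : Finset α) :
    DependsOn (fun ω => ω ∈ levelEvent A J) (levelVars (fun a => vbl (A a)) J) := by
  intro ω ω' h
  simp only [levelEvent, Set.mem_iInter, eq_iff_iff]
  refine forall₂_congr fun a ha => Iff.of_eq (dependsOn_vbl (A a) fun i hi => h i ?_)
  exact Set.mem_biUnion (show a ∈ (J : Set α) from ha) hi

theorem levelEvent_insert (a : α) (J : Finset α) :
    levelEvent A (insert a J) = A a ∩ levelEvent A J := by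
  simp [levelEvent]

variable [∀ i, MeasurableSpace (Ω i)]

theorem measurableSet_levelEvent {A : α → Set (∀ i, Ω i)} (hA : ∀ a, MeasurableSet (A a))
    (J : Finset α) : MeasurableSet (levelEvent A J) :=
  J.measurableSet_biInter fun a _ => hA a

variable [Fintype I] (μ : ∀ i, Measure (Ω i))

/-- The probability, starting from the assignment `ω`, that the levels of a witness hold when they
are tested one after the other, the variables of a level being resampled after its test. -/
noncomputable def witnessProb : List (Finset α) → (∀ i, Ω i) → ℝ≥0∞
  | [], _ => 1
  | J :: τ, ω => (levelEvent A J).indicator 1 ω *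
      resample μ (levelVars (fun a => vbl (A a)) J) (witnessProb τ) ω

variable [∀ i, IsProbabilityMeasure (μ i)] {A}

theorem measurable_witnessProb (hA : ∀ a, MeasurableSet (A a)) :
    ∀ τ : List (Finset α), Measurable (witnessProb A μ τ)
  | [] => measurable_const
  | J :: τ => (measurable_one.indicator (measurableSet_levelEvent hA J)).mul
      (measurable_resample μ _ (measurable_witnessProb hA τ))

/-- The test of `τ` never reads a variable of `f`, and resamplings commute. -/
theorem resample_witnessProb_of_not_meets {f : α} : ∀ {τ : List (Finset α)},
    ¬Meets (fun a => vbl (A a)) f τ → (∀ a, MeasurableSet (A a)) →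
      resample μ (vbl (A f)) (witnessProb A μ τ) = witnessProb A μ τ
  | [], _, _ => by
    funext ω
    simp [resample, witnessProb]
  | J :: τ, h, hA => by
    simp only [meets_cons, not_or, not_not] at h
    funext ω
    simp only [witnessProb]
    rw [resample_indicator_mul μ (dependsOn_levelEvent A J) h.1.symm,
      resample_resample μ _ _ (measurable_witnessProb μ hA τ), Set.union_comm,
      ← resample_resample μ _ _ (measurable_witnessProb μ hA τ),
      resample_witnessProb_of_not_meets h.2 hA]

/-- Resampling a true event `f` and then testing `τ` succeeds with at most the probability with
which testing `τ` with `f` inserted does. -/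
theorem resample_witnessProb_le {f : α} (hA : ∀ a, MeasurableSet (A a)) :
    ∀ {τ : List (Finset α)} {ω : ∀ i, Ω i}, ω ∈ A f →
      resample μ (vbl (A f)) (witnessProb A μ τ) ω ≤
        witnessProb A μ (insertEvent (fun a => vbl (A a)) f τ) ω
  | [], ω, hω => by simp [resample, witnessProb, insertEvent]
  | [J], ω, hω => by
    by_cases hJ : Disjoint (vbl (A f)) (levelVars (fun a => vbl (A a)) J)
    · rw [resample_witnessProb_of_not_meets μ (by simpa [Meets] using hJ) hA]
      simp [insertEvent, hJ]
    · rw [insertEvent, if_neg hJ, witnessProb, levelVars_singleton]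
      simp [levelEvent, hω]
  | J :: K :: L, ω, hω => by
    have hm := measurable_witnessProb μ hA (K :: L)
    by_cases hJ : Disjoint (vbl (A f)) (levelVars (fun a => vbl (A a)) J)
    -- The test of `J` does not see the variables of `f`, so resampling `f` can be postponed past it
    -- and merged with the resampling of `J`.
    · have key : resample μ (vbl (A f)) (witnessProb A μ (J :: K :: L)) ω =
          (levelEvent A J).indicator 1 ω * resample μ
            (levelVars (fun a => vbl (A a)) J ∪ vbl (A f)) (witnessProb A μ (K :: L)) ω := by
        have : witnessProb A μ (J :: K :: L) = fun ω => (levelEvent A J).indicator 1 ω *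
          resample μ (levelVars (fun a => vbl (A a)) J) (witnessProb A μ (K :: L)) ω := rfl
        rw [this, resample_indicator_mul μ (dependsOn_levelEvent A J) hJ.symm,
          resample_resample μ _ _ hm, Set.union_comm]
      rw [key]
      by_cases hK : Disjoint (vbl (A f)) (levelVars (fun a => vbl (A a)) K)
      -- Here `f` goes above `J`. Resampling `J` leaves the variables of `f` alone, so `f` still
      -- holds afterwards and the recursion applies.
      · rw [insertEvent, if_pos hJ, if_pos hK, witnessProb, ← resample_resample μ _ _ hm]
        refine mul_le_mul_right (resample_mono μ _ fun y => ?_) _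
        refine resample_witnessProb_le hA ?_
        refine (dependsOn_vbl (A f) fun i hi => ?_).mpr hω
        exact Set.piecewise_eq_of_notMem _ _ _ (Set.disjoint_left.1 hJ hi)
      -- Here `f` joins `J`. Both sides agree, as `f` holds at `ω`.
      · rw [insertEvent, if_pos hJ, if_neg hK, witnessProb, levelVars_insert, levelEvent_insert,
          Set.union_comm]
        refine le_of_eq ?_
        by_cases hJω : ω ∈ levelEvent A J <;> simp [hJω, hω]
    · rw [insertEvent, if_neg hJ, witnessProb, levelVars_singleton]
      simp [levelEvent, hω]

theorem measure_levelEvent (hA : ∀ a, MeasurableSet (A a)) {J : Finset α}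
    (hJ : (J : Set α).PairwiseDisjoint fun a => vbl (A a)) :
    Measure.pi μ (levelEvent A J) = ∏ a ∈ J, Measure.pi μ (A a) := by
  induction J using Finset.induction_on with
  | empty => simp [levelEvent]
  | insert a J ha ih =>
    rw [Finset.coe_insert] at hJ
    have hd : Disjoint (levelVars (fun a => vbl (A a)) J) (vbl (A a)) := by
      rw [disjoint_levelVars_left]
      intro b hb
      exact hJ (Set.mem_insert_of_mem _ hb) (Set.mem_insert _ _) fun h => ha (h ▸ hb)
    have hJm := measurableSet_levelEvent hA J
    have := lintegral_indicator_mul_resample μ (hA a) (dependsOn_vbl (A a))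
      (measurable_one.indicator hJm)
    rw [resample_of_dependsOn μ (dependsOn_indicator (dependsOn_levelEvent A J)) hd,
      lintegral_indicator_one hJm] at this
    rw [Finset.prod_insert ha, ← ih (hJ.subset (Set.subset_insert _ _)), ← this, levelEvent_insert,
      ← lintegral_indicator_one ((hA a).inter hJm)]
    refine lintegral_congr fun ω => ?_
    by_cases h1 : ω ∈ A a <;> by_cases h2 : ω ∈ levelEvent A J <;> simp [h1, h2]

/-- The product of the probabilities of the events in a list of levels. -/
noncomputable def levelsWeight (w : α → ℝ≥0∞) (τ : List (Finset α)) : ℝ≥0∞ :=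
  (τ.map fun J => ∏ a ∈ J, w a).prod

theorem lintegral_witnessProb (hA : ∀ a, MeasurableSet (A a)) : ∀ {τ : List (Finset α)},
    IsWitness (fun a => vbl (A a)) τ →
      ∫⁻ ω, witnessProb A μ τ ω ∂Measure.pi μ = levelsWeight (fun a => Measure.pi μ (A a)) τ := by
  have step : ∀ {J : Finset α} {τ : List (Finset α)}, IsWitness (fun a => vbl (A a)) (J :: τ) →
      ∫⁻ ω, witnessProb A μ (J :: τ) ω ∂Measure.pi μ =
        (∏ a ∈ J, Measure.pi μ (A a)) * ∫⁻ ω, witnessProb A μ τ ω ∂Measure.pi μ := by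
    intro J τ h
    rw [← measure_levelEvent μ hA h.head_pairwiseDisjoint]
    exact lintegral_indicator_mul_resample μ (measurableSet_levelEvent hA J)
      (dependsOn_levelEvent A J) (measurable_witnessProb μ hA τ)
  intro τ h
  induction τ with
  | nil => exact h.elim
  | cons J L ih =>
    rw [step h, levelsWeight, List.map_cons, List.prod_cons]
    cases L with
    | nil => simp [witnessProb]
    | cons K L => rw [ih h.2.2.2, levelsWeight]

end WitnessProbability

/-! ### Splitting off the first of a sequence of independent samples -/

section Stream

/-- The sequence `x, y 0, y 1, …`. -/
def natCons {X : Type*} (x : X) (y : ℕ → X) : ℕ → X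
  | 0 => x
  | n + 1 => y n

variable {X : Type*} [MeasurableSpace X]

theorem measurable_natCons : Measurable fun p : X × (ℕ → X) => natCons p.1 p.2 := by
  refine measurable_pi_lambda _ fun n => ?_
  cases n with
  | zero => exact measurable_fst
  | succ n => exact (measurable_pi_apply (X := fun _ : ℕ => X) n).comp measurable_snd

theorem map_natCons_prod_infinitePi (ν : Measure X) [IsProbabilityMeasure ν] :
    Measure.map (fun p : X × (ℕ → X) => natCons p.1 p.2)
      (ν.prod (Measure.infinitePi fun _ : ℕ => ν)) = Measure.infinitePi fun _ : ℕ => ν := by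
  classical
  refine Measure.eq_infinitePi _ fun s t ht => ?_
  rw [Measure.map_apply measurable_natCons (.pi s.countable_toSet fun i _ => ht i)]
  let s' : Finset ℕ := (s.erase 0).image Nat.pred
  have hpre : (fun p : X × (ℕ → X) => natCons p.1 p.2) ⁻¹' Set.pi s t =
      (if 0 ∈ s then t 0 else Set.univ) ×ˢ Set.pi s' fun n => t (n + 1) := by
    ext ⟨x, y⟩
    simp only [Set.mem_preimage, Set.mem_pi, Set.mem_prod, s', Finset.coe_image, Finset.coe_erase]
    constructor
    · intro h
      refine ⟨?_, ?_⟩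
      · split_ifs with h0
        · exact h 0 h0
        · trivial
      · rintro n ⟨m, ⟨hm, hm0⟩, rfl⟩
        obtain ⟨k, rfl⟩ := Nat.exists_eq_succ_of_ne_zero hm0
        exact h (k + 1) hm
    · rintro ⟨h0, h⟩ n hn
      cases n with
      | zero =>
        rw [if_pos (show 0 ∈ s from hn)] at h0
        exact h0
      | succ n => exact h n ⟨n + 1, ⟨hn, by simp⟩, rfl⟩
  rw [hpre, Measure.prod_prod,
    Measure.infinitePi_pi (s := s') (t := fun n => t (n + 1)) (μ := fun _ => ν) fun i _ => ht (i + 1),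
    Finset.prod_image]
  · have hrec : (∏ n ∈ s.erase 0, ν (t (Nat.pred n + 1))) = ∏ n ∈ s.erase 0, ν (t n) :=
      Finset.prod_congr rfl fun n hn => by
        rw [Nat.pred_eq_sub_one, Nat.sub_add_cancel]
        exact Nat.one_le_iff_ne_zero.2 (Finset.ne_of_mem_erase hn)
    rw [hrec]
    split_ifs with h0
    · exact Finset.mul_prod_erase s (fun n => ν (t n)) h0
    · rw [measure_univ, one_mul, Finset.erase_eq_of_notMem h0]
  · intro m hm n hn h
    have hm' := Finset.ne_of_mem_erase hm
    have hn' := Finset.ne_of_mem_erase hn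
    simp only [Nat.pred_eq_sub_one] at h
    omega

/-- Stated as an inequality so that no measurability of `F` is required; in particular the shifted
rule need not be treated as jointly measurable in the assignment it has seen. -/
theorem lintegral_infinitePi_le (ν : Measure X) [IsProbabilityMeasure ν] (F : (ℕ → X) → ℝ≥0∞) :
    ∫⁻ y, F y ∂(Measure.infinitePi fun _ : ℕ => ν) ≤
      ∫⁻ x, ∫⁻ y, F (natCons x y) ∂(Measure.infinitePi fun _ : ℕ => ν) ∂ν := by
  conv_lhs => rw [← map_natCons_prod_infinitePi]
  exact (lintegral_map_le _ _).trans (lintegral_prod_le _)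

end Stream

/-! ### The run of the algorithm, analysed by its first round -/

section Run

open scoped Classical

variable {I : Type u} {Ω : I → Type v} [∀ i, MeasurableSpace (Ω i)] {α : Type w}
  {A : α → Set (∀ i, Ω i)} {R : Type z} [MeasurableSpace R]

/-- The rule that `σ` follows after a first round in which it saw the assignment `ω`. -/
def SelectionRule.shift (σ : SelectionRule A R) (ω : ∀ i, Ω i) : SelectionRule A R where
  select r t h := σ.select r (t + 1) (Fin.cons (α := fun _ => ∀ i, Ω i) ω h)
  measurableSet_select t a := by
    have hm : Measurable fun p : R × (Fin (t + 1) → ∀ i, Ω i) =>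
        (p.1, (Fin.cons (α := fun _ => ∀ i, Ω i) ω p.2 : Fin (t + 2) → ∀ i, Ω i)) := by
      refine measurable_fst.prodMk (measurable_pi_lambda _ fun j => ?_)
      refine Fin.cases ?_ (fun j => ?_) j
      · simp
      · simp only [Fin.cons_succ]
        exact (measurable_pi_apply (X := fun _ : Fin (t + 1) => ∀ i, Ω i) j).comp measurable_snd
    exact hm (σ.measurableSet_select (t + 1) a)
  select_mem r t h hh := by
    have hl : (Fin.cons (α := fun _ => ∀ i, Ω i) ω h : Fin (t + 2) → ∀ i, Ω i) (Fin.last (t + 1)) =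
        h (Fin.last t) := by
      rw [← Fin.succ_last, Fin.cons_succ]
    have := σ.select_mem r (t + 1) (Fin.cons (α := fun _ => ∀ i, Ω i) ω h)
    rw [hl] at this
    exact this hh

/-- After one round the algorithm restarts, under the shifted rule, from `mtState σ r y 1`. The
sample `y 1` belongs to the first round, so the fresh samples continue with `y 2`. -/
theorem mtHistory_succ (σ : SelectionRule A R) (r : R) (y : ℕ → ∀ i, Ω i) (t : ℕ) :
    mtHistory σ r y (t + 1) = Fin.cons (α := fun _ => ∀ i, Ω i) (y 0)
      (mtHistory (σ.shift (y 0)) r (natCons (mtState σ r y 1) fun n => y (n + 2)) t) := by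
  induction t with
  | zero =>
    funext j
    refine Fin.cases ?_ (fun j => ?_) j
    · rfl
    · rw [Fin.cons_succ, Subsingleton.elim j 0]
      rfl
  | succ t ih =>
    have hl : mtHistory σ r y (t + 1) (Fin.last (t + 1)) =
        mtHistory (σ.shift (y 0)) r (natCons (mtState σ r y 1) fun n => y (n + 2)) t
          (Fin.last t) := by
      rw [ih, ← Fin.succ_last, Fin.cons_succ]
    have h1 : mtHistory σ r y (t + 1 + 1) = Fin.snoc (α := fun _ => ∀ i, Ω i)
        (mtHistory σ r y (t + 1))
        (if ∃ a, mtHistory σ r y (t + 1) (Fin.last (t + 1)) ∈ A a then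
          (vbl (A (σ.select r (t + 1) (mtHistory σ r y (t + 1))))).piecewise (y (t + 1 + 1))
            (mtHistory σ r y (t + 1) (Fin.last (t + 1)))
        else mtHistory σ r y (t + 1) (Fin.last (t + 1))) := rfl
    rw [h1, hl, ih, ← Fin.cons_snoc_eq_snoc_cons]
    rfl

/-- The event resampled in round `t`, if the algorithm has not stopped. -/
noncomputable def mtLog (σ : SelectionRule A R) (r : R) (y : ℕ → ∀ i, Ω i) (t : ℕ) : Option α :=
  if ∃ a, mtState σ r y t ∈ A a then some (σ.select r t (mtHistory σ r y t)) else none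

theorem mtLog_succ (σ : SelectionRule A R) (r : R) (y : ℕ → ∀ i, Ω i) (t : ℕ) :
    mtLog σ r y (t + 1) =
      mtLog (σ.shift (y 0)) r (natCons (mtState σ r y 1) fun n => y (n + 2)) t := by
  have hl : mtState σ r y (t + 1) =
      mtState (σ.shift (y 0)) r (natCons (mtState σ r y 1) fun n => y (n + 2)) t := by
    rw [mtState, mtHistory_succ, ← Fin.succ_last, Fin.cons_succ]
    rfl
  rw [mtLog, mtLog, hl, mtHistory_succ]
  rfl

theorem mtState_one (σ : SelectionRule A R) (r : R) (y : ℕ → ∀ i, Ω i)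
    (h : ∃ a, y 0 ∈ A a) :
    mtState σ r y 1 = (vbl (A (σ.select r 0 fun _ => y 0))).piecewise (y 1) (y 0) := by
  have : mtState σ r y 1 = if ∃ a, y 0 ∈ A a then
      (vbl (A (σ.select r 0 fun _ => y 0))).piecewise (y 1) (y 0) else y 0 := rfl
  rw [this, if_pos h]

theorem mtLog_zero (σ : SelectionRule A R) (r : R) (y : ℕ → ∀ i, Ω i) :
    mtLog σ r y 0 = if ∃ a, y 0 ∈ A a then some (σ.select r 0 fun _ => y 0) else none := rfl

/-- The event resampled in a round holds at the beginning of that round. -/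
theorem mtState_mem_of_mtLog {σ : SelectionRule A R} {r : R} {y : ℕ → ∀ i, Ω i} {t : ℕ} {a : α}
    (h : mtLog σ r y t = some a) : mtState σ r y t ∈ A a := by
  rw [mtLog] at h
  split_ifs at h with h'
  rw [← Option.some.inj h]
  exact σ.select_mem r t _ h'

theorem mtLog_eq_none {σ : SelectionRule A R} {r : R} {y : ℕ → ∀ i, Ω i} {t : ℕ} :
    mtLog σ r y t = none ↔ ¬∃ a, mtState σ r y t ∈ A a := by
  rw [mtLog]
  split_ifs with h <;> simpa using h

theorem mtLog_succ_eq_none {σ : SelectionRule A R} {r : R} {y : ℕ → ∀ i, Ω i} {t : ℕ}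
    (h : mtLog σ r y t = none) : mtLog σ r y (t + 1) = none := by
  rw [mtLog_eq_none] at h ⊢
  have h1 : mtState σ r y (t + 1) = mtState σ r y t := by
    rw [mtState, mtHistory, Fin.snoc_last]
    exact if_neg h
  rwa [h1]

theorem mtLog_eq_none_mono {σ : SelectionRule A R} {r : R} {y : ℕ → ∀ i, Ω i} {s t : ℕ}
    (hst : s ≤ t) (h : mtLog σ r y s = none) : mtLog σ r y t = none :=
  Nat.le_induction h (fun _ _ ih => mtLog_succ_eq_none ih) t hst

theorem logWitness_mtLog_natCons (V : α → Set I) (σ : SelectionRule A R) (r : R) (ω : ∀ i, Ω i)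
    (y : ℕ → ∀ i, Ω i) (h : ∃ a, ω ∈ A a) (t : ℕ) :
    logWitness V (mtLog σ r (natCons ω y)) (t + 1) =
      insertEvent V (σ.select r 0 fun _ => ω) (logWitness V (mtLog (σ.shift ω) r
        (natCons ((vbl (A (σ.select r 0 fun _ => ω))).piecewise (y 0) ω) fun n => y (n + 1))) t) := by
  have h0 : mtLog σ r (natCons ω y) 0 = some (σ.select r 0 fun _ => ω) := by
    rw [mtLog_zero]
    exact if_pos h
  rw [logWitness, h0, Option.elim]
  congr 2
  funext s
  rw [mtLog_succ, mtState_one σ r _ h]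
  rfl

variable [Fintype I] (μ : ∀ i, Measure (Ω i)) [∀ i, IsProbabilityMeasure (μ i)]

/-- Induction on the number of rounds, for all rules and starting assignments at once, because the
rest of the run follows another rule from another assignment. The seed stays fixed. -/
theorem lintegral_logWitness_le_of_state (hA : ∀ a, MeasurableSet (A a))
    (hne : ∀ a, (A a).Nonempty → (vbl (A a)).Nonempty) (r : R) (M : ℕ) :
    ∀ (σ : SelectionRule A R) (ω : ∀ i, Ω i) (τ : List (Finset α)),
      IsWitness (fun a => vbl (A a)) τ →
      ∫⁻ y, ∑ t ∈ Finset.range M,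
        (if logWitness (fun a => vbl (A a)) (mtLog σ r (natCons ω y)) t = τ then 1 else 0 : ℝ≥0∞)
          ∂(Measure.infinitePi fun _ : ℕ => Measure.pi μ) ≤ witnessProb A μ τ ω := by
  induction M with
  | zero => simp
  | succ M ih =>
    intro σ ω τ hτ
    by_cases hω : ∃ a, ω ∈ A a
    swap
    · have h0 : ∀ y t, logWitness (fun a => vbl (A a)) (mtLog σ r (natCons ω y)) t ≠ τ := by
        intro y t h
        have : mtLog σ r (natCons ω y) 0 = none := by
          rw [mtLog_zero, if_neg]
          exact hω
        refine hτ.ne_nil (h.symm.trans ?_)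
        cases t <;> simp [logWitness, this]
      simp [h0]
    set f := σ.select r 0 fun _ => ω with hf
    have hωf : ω ∈ A f := σ.select_mem r 0 (fun _ => ω) hω
    have hVf : (vbl (A f)).Nonempty := hne f ⟨ω, hωf⟩
    have hfirst : ∀ y, logWitness (fun a => vbl (A a)) (mtLog σ r (natCons ω y)) 0 = [{f}] := by
      intro y
      have : mtLog σ r (natCons ω y) 0 = some f := by
        rw [mtLog_zero, if_pos]
        · rfl
        · exact hω
      simp [logWitness, this]
    simp only [Finset.sum_range_succ', hfirst,
      logWitness_mtLog_natCons (fun a => vbl (A a)) σ r ω _ hω, ← hf]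
    -- If `τ = [{f}]`, only round `0` has this witness, and `τ` passes its test with probability `1`
    -- because `f` holds at `ω`.
    by_cases hτf : [{f}] = τ
    · have hz : ∀ a t, insertEvent (fun a => vbl (A a)) f (logWitness (fun a => vbl (A a)) a t) ≠
          τ := by
        intro a t h
        rcases isWitness_logWitness (fun a => vbl (A a)) t a with h0 | h0
        · rw [h0, insertEvent] at h
          exact hτ.ne_nil h.symm
        · exact insertEvent_ne_singleton (V := fun a => vbl (A a)) hVf h0 (h.trans hτf.symm)
      simp only [hz, if_false, Finset.sum_const_zero, if_pos hτf]
      rw [← hτf]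
      simp [witnessProb, levelEvent, hωf, resample]
    · simp only [if_neg hτf, add_zero]
      -- By injectivity a later round has witness `τ` only if its witness in the rest of the run is
      -- the one `τ'`. The induction hypothesis, averaged over the first resampling, bounds the
      -- count by `resample` of `witnessProb τ'`.
      by_cases hex : ∃ τ', IsWitness (fun a => vbl (A a)) τ' ∧
          insertEvent (fun a => vbl (A a)) f τ' = τ
      · obtain ⟨τ', hτ', rfl⟩ := hex
        refine le_trans ?_ (resample_witnessProb_le μ hA hωf)
        refine le_trans (lintegral_infinitePi_le _ _) (lintegral_mono fun x => ?_)
        refine le_trans (lintegral_mono fun y => Finset.sum_le_sum fun t _ => ?_)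
          (ih (σ.shift ω) ((vbl (A f)).piecewise x ω) τ' hτ')
        split_ifs with h1 h2
        · exact le_rfl
        · refine absurd ?_ h2
          rcases isWitness_logWitness (fun a => vbl (A a)) t (mtLog (σ.shift ω) r
            (natCons ((vbl (A f)).piecewise x ω) y)) with h0 | h0
          · exfalso
            refine hτ.ne_nil (h1.symm.trans ?_)
            exact (congrArg _ h0).trans (by rw [insertEvent])
          · exact insertEvent_injOn (V := fun a => vbl (A a)) hVf h0 hτ' h1
        · exact zero_le_one
        · exact le_rfl
      · have hz : ∀ a t, insertEvent (fun a => vbl (A a)) f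
            (logWitness (fun a => vbl (A a)) a t) ≠ τ := by
          intro a t h
          rcases isWitness_logWitness (fun a => vbl (A a)) t a with h0 | h0
          · rw [h0, insertEvent] at h
            exact hτ.ne_nil h.symm
          · exact hex ⟨_, h0, h⟩
        simp [hz]

/-- The expected number of rounds of the Moser-Tardos algorithm with a given witness is at most the
product of the probabilities of the events in the witness. -/
theorem lintegral_logWitness_le (hA : ∀ a, MeasurableSet (A a))
    (hne : ∀ a, (A a).Nonempty → (vbl (A a)).Nonempty) (ρ : Measure R) [IsProbabilityMeasure ρ]
    (σ : SelectionRule A R) (M : ℕ) {τ : List (Finset α)} (hτ : IsWitness (fun a => vbl (A a)) τ) :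
    ∫⁻ p, ∑ t ∈ Finset.range M,
      (if logWitness (fun a => vbl (A a)) (mtLog σ p.1 p.2) t = τ then 1 else 0 : ℝ≥0∞)
        ∂(mtMeasure μ ρ) ≤ levelsWeight (fun a => Measure.pi μ (A a)) τ := by
  refine (lintegral_prod_le _).trans ?_
  refine (lintegral_mono fun r => (lintegral_infinitePi_le _ _).trans
    (lintegral_mono fun ω => lintegral_logWitness_le_of_state μ hA hne r M σ ω τ hτ)).trans ?_
  rw [lintegral_witnessProb μ hA hτ]
  simp

end Run

/-! ### Measurability of the run and of its witnesses -/

section Measurability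

open scoped Classical

variable {I : Type u} {Ω : I → Type v} [∀ i, MeasurableSpace (Ω i)] {α : Type w} [Fintype α]
  {A : α → Set (∀ i, Ω i)} {R : Type z} [MeasurableSpace R]

theorem measurable_mtHistory (hA : ∀ a, MeasurableSet (A a)) (σ : SelectionRule A R) (t : ℕ) :
    Measurable fun p : R × (ℕ → ∀ i, Ω i) => mtHistory σ p.1 p.2 t := by
  have hy : ∀ n : ℕ, Measurable fun p : R × (ℕ → ∀ i, Ω i) => p.2 n := fun n =>
    (measurable_pi_apply (X := fun _ : ℕ => ∀ i, Ω i) n).comp measurable_snd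
  induction t with
  | zero => exact measurable_pi_lambda _ fun _ => hy 0
  | succ t ih =>
    have hlast : Measurable fun p : R × (ℕ → ∀ i, Ω i) =>
        mtHistory σ p.1 p.2 t (Fin.last t) :=
      (measurable_pi_apply (X := fun _ : Fin (t + 1) => ∀ i, Ω i) (Fin.last t)).comp ih
    have hsel : ∀ a, MeasurableSet
        {p : R × (ℕ → ∀ i, Ω i) | σ.select p.1 t (mtHistory σ p.1 p.2 t) = a} := fun a =>
      (measurable_fst.prodMk ih) (σ.measurableSet_select t a)
    have hbad : MeasurableSet
        {p : R × (ℕ → ∀ i, Ω i) | ∃ a, mtHistory σ p.1 p.2 t (Fin.last t) ∈ A a} := by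
      rw [Set.ofPred_exists]
      exact MeasurableSet.iUnion fun a => hlast (hA a)
    refine measurable_pi_lambda _ fun j => ?_
    refine Fin.lastCases ?_ (fun j => ?_) j
    · simp only [mtHistory, Fin.snoc_last]
      refine Measurable.ite hbad ?_ hlast
      have hpw : ∀ a, Measurable fun p : R × (ℕ → ∀ i, Ω i) =>
          (vbl (A a)).piecewise (p.2 (t + 1)) (mtHistory σ p.1 p.2 t (Fin.last t)) := fun a =>
        (measurable_piecewise_prod (vbl (A a))).comp ((hy (t + 1)).prodMk hlast)
      intro s hs
      have : (fun p : R × (ℕ → ∀ i, Ω i) =>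
          (vbl (A (σ.select p.1 t (mtHistory σ p.1 p.2 t)))).piecewise (p.2 (t + 1))
            (mtHistory σ p.1 p.2 t (Fin.last t))) ⁻¹' s =
          ⋃ a, {p : R × (ℕ → ∀ i, Ω i) | σ.select p.1 t (mtHistory σ p.1 p.2 t) = a} ∩
            (fun p : R × (ℕ → ∀ i, Ω i) => (vbl (A a)).piecewise (p.2 (t + 1))
              (mtHistory σ p.1 p.2 t (Fin.last t))) ⁻¹' s := by
        ext p
        simp
      rw [this]
      exact MeasurableSet.iUnion fun a => (hsel a).inter (hpw a hs)
    · simp only [mtHistory, Fin.snoc_castSucc]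
      exact (measurable_pi_apply (X := fun _ : Fin (t + 1) => ∀ i, Ω i) j).comp ih

theorem measurableSet_mtState_bad (hA : ∀ a, MeasurableSet (A a)) (σ : SelectionRule A R) (t : ℕ) :
    MeasurableSet {p : R × (ℕ → ∀ i, Ω i) | ∃ a, mtState σ p.1 p.2 t ∈ A a} := by
  rw [Set.ofPred_exists]
  exact MeasurableSet.iUnion fun a =>
    ((measurable_pi_apply (X := fun _ : Fin (t + 1) => ∀ i, Ω i) (Fin.last t)).comp
      (measurable_mtHistory hA σ t)) (hA a)

theorem measurableSet_mtLog (hA : ∀ a, MeasurableSet (A a)) (σ : SelectionRule A R) (t : ℕ)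
    (o : Option α) : MeasurableSet {p : R × (ℕ → ∀ i, Ω i) | mtLog σ p.1 p.2 t = o} := by
  cases o with
  | none =>
    simp only [mtLog_eq_none]
    exact (measurableSet_mtState_bad hA σ t).compl
  | some a =>
    have : {p : R × (ℕ → ∀ i, Ω i) | mtLog σ p.1 p.2 t = some a} =
        {p | ∃ a, mtState σ p.1 p.2 t ∈ A a} ∩
          {p | σ.select p.1 t (mtHistory σ p.1 p.2 t) = a} := by
      ext p
      by_cases h : ∃ a, mtState σ p.1 p.2 t ∈ A a
      · simp [mtLog, h]
      · simp [mtLog, h]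
    rw [this]
    exact (measurableSet_mtState_bad hA σ t).inter
      ((measurable_fst.prodMk (measurable_mtHistory hA σ t)) (σ.measurableSet_select t a))

theorem measurableSet_logWitness {P : Type*} [MeasurableSpace P] (V : α → Set I) (t : ℕ) :
    ∀ {a : P → ℕ → Option α}, (∀ s o, MeasurableSet {p | a p s = o}) →
      ∀ τ, MeasurableSet {p | logWitness V (a p) t = τ} := by
  induction t with
  | zero =>
    intro a ha τ
    have : {p | logWitness V (a p) 0 = τ} = ⋃ o : Option α, {p | a p 0 = o} ∩
        {_p | (o.elim [] fun f => [{f}]) = τ} := by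
      ext p
      simp [logWitness]
    rw [this]
    exact MeasurableSet.iUnion fun o => (ha 0 o).inter (MeasurableSet.const _)
  | succ t ih =>
    intro a ha τ
    have : {p | logWitness V (a p) (t + 1) = τ} = ⋃ o : Option α, ⋃ τ' : List (Finset α),
        ({p | a p 0 = o} ∩ {p | logWitness V (fun s => a p (s + 1)) t = τ'}) ∩
          {_p | (o.elim [] fun f => insertEvent V f τ') = τ} := by
      ext p
      simp [logWitness]
    rw [this]
    exact MeasurableSet.iUnion fun o => MeasurableSet.iUnion fun τ' =>
      ((ha 0 o).inter (ih (fun s o => ha (s + 1) o) τ')).inter (MeasurableSet.const _)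

end Measurability

/-! ### The total weight of all witnesses -/

section Counting

open scoped Classical

variable {I : Type u} {α : Type w} [Fintype α] (V : α → Set I)

/-- The events other than `a` that share a variable with `a`, together with `a`. -/
noncomputable def closedNbhd (a : α) : Finset α :=
  insert a (Finset.univ.filter fun b => b ≠ a ∧ (V b ∩ V a).Nonempty)

/-- The levels that can be put below the deepest level of a list. -/
noncomputable def nextLevels (τ : List (Finset α)) : Finset (Finset α) :=
  ((τ.head?.getD ∅).biUnion (closedNbhd V)).powerset

/-- A finite set that contains all witnesses with `d + 1` levels. -/
noncomputable def witnessesOfDepth : ℕ → Finset (List (Finset α))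
  | 0 => Finset.univ.image fun a => [{a}]
  | d + 1 => (witnessesOfDepth d).biUnion fun τ =>
      ((nextLevels V τ).filter Finset.Nonempty).image fun J => J :: τ

theorem mem_closedNbhd_of_not_disjoint {a b : α} (h : ¬Disjoint (V a) (V b)) :
    a ∈ closedNbhd V b := by
  by_cases hab : a = b
  · simp [closedNbhd, hab]
  · simp [closedNbhd, hab, Set.not_disjoint_iff_nonempty_inter.1 h]

theorem IsWitness.mem_witnessesOfDepth : ∀ {d : ℕ} {τ : List (Finset α)}, IsWitness V τ →
    τ.length = d + 1 → τ ∈ witnessesOfDepth V d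
  | 0, [], h, _ => h.elim
  | _ + 1, [], h, _ => h.elim
  | 0, [J], h, _ => by
    obtain ⟨a, rfl⟩ := h
    simp [witnessesOfDepth]
  | d + 1, [J], _, hl => by simp at hl
  | 0, J :: K :: L, _, hl => by simp at hl
  | d + 1, J :: K :: L, h, hl => by
    rw [witnessesOfDepth, Finset.mem_biUnion]
    refine ⟨K :: L, mem_witnessesOfDepth h.2.2.2 (by simpa using hl), ?_⟩
    refine Finset.mem_image_of_mem _ (Finset.mem_filter.2 ⟨?_, h.1⟩)
    simp only [nextLevels, List.head?_cons, Option.getD_some, Finset.mem_powerset]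
    intro a ha
    have := h.2.1 a ha
    rw [disjoint_comm, disjoint_levelVars_left] at this
    push Not at this
    obtain ⟨b, hb, hab⟩ := this
    exact Finset.mem_biUnion.2 ⟨b, hb, mem_closedNbhd_of_not_disjoint V fun h => hab h.symm⟩

theorem length_of_mem_witnessesOfDepth : ∀ {d : ℕ} {τ : List (Finset α)},
    τ ∈ witnessesOfDepth V d → τ.length = d + 1
  | 0, τ, h => by
    simp only [witnessesOfDepth, Finset.mem_image] at h
    obtain ⟨a, _, rfl⟩ := h
    rfl
  | d + 1, τ, h => by
    simp only [witnessesOfDepth, Finset.mem_biUnion, Finset.mem_image] at h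
    obtain ⟨τ', hτ', J, _, rfl⟩ := h
    simp [length_of_mem_witnessesOfDepth hτ']

theorem prod_biUnion_le_prod_prod {β γ : Type*} (s : Finset β) (t : β → Finset γ) {f : γ → ℝ≥0∞}
    (hf : ∀ c, 1 ≤ f c) : ∏ c ∈ s.biUnion t, f c ≤ ∏ b ∈ s, ∏ c ∈ t b, f c := by
  induction s using Finset.induction_on with
  | empty => simp
  | insert b s hb ih =>
    rw [Finset.biUnion_insert, Finset.prod_insert hb]
    refine le_trans ?_ (mul_le_mul_right ih _)
    rw [← Finset.prod_union_inter]
    exact le_mul_of_one_le_right zero_le (Finset.one_le_prod' fun c _ => hf c)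

variable {V} {w ψ : α → ℝ≥0∞}

/-- Summing `∏ ψ` over all subsets of a set gives `∏ (1 + ψ)`. Overlaps between neighbourhoods only
help, as the factors are at least `1`, so `h` can be applied to each event of `K` separately. -/
theorem sum_nextLevels_le (h : ∀ a, w a * ∏ b ∈ closedNbhd V a, (1 + ψ b) ≤ ψ a)
    (K : Finset α) (L : List (Finset α)) :
    (∏ a ∈ K, w a) * ∑ J ∈ nextLevels V (K :: L), ∏ a ∈ J, ψ a ≤ ∏ a ∈ K, ψ a := by
  simp only [nextLevels, List.head?_cons, Option.getD_some]
  rw [← Finset.prod_one_add]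
  refine (mul_le_mul_right (prod_biUnion_le_prod_prod K (closedNbhd V) fun c =>
    le_self_add) _).trans ?_
  rw [← Finset.prod_mul_distrib]
  exact Finset.prod_le_prod' fun a _ => h a

/-- The weight of a list of levels with the deepest level weighted by `ψ`. -/
noncomputable def headWeight (w ψ : α → ℝ≥0∞) (τ : List (Finset α)) : ℝ≥0∞ :=
  (∏ a ∈ τ.head?.getD ∅, ψ a) * levelsWeight w τ.tail

/-- One telescoping step: the weight `ψ` on the deepest level pays both for ending the list there
(the empty next level, the summand `1`) and for every nonempty next level. -/
theorem sum_headWeight_succ_le (h : ∀ a, w a * ∏ b ∈ closedNbhd V a, (1 + ψ b) ≤ ψ a) (d : ℕ) :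
    ∑ τ ∈ witnessesOfDepth V d, levelsWeight w τ +
      ∑ τ ∈ witnessesOfDepth V (d + 1), headWeight w ψ τ ≤
        ∑ τ ∈ witnessesOfDepth V d, headWeight w ψ τ := by
  have h1 : ∑ τ ∈ witnessesOfDepth V (d + 1), headWeight w ψ τ ≤
      ∑ τ ∈ witnessesOfDepth V d, ∑ J ∈ (nextLevels V τ).filter Finset.Nonempty,
        headWeight w ψ (J :: τ) := by
    rw [witnessesOfDepth]
    rw [Finset.sum_biUnion]
    · refine Finset.sum_le_sum fun τ _ => ?_
      rw [Finset.sum_image fun J _ J' _ hJ => (List.cons.inj hJ).1]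
    · intro τ _ τ' _ hne
      refine Finset.disjoint_left.2 fun σ hσ hσ' => hne ?_
      obtain ⟨J, _, rfl⟩ := Finset.mem_image.1 hσ
      obtain ⟨J', _, h'⟩ := Finset.mem_image.1 hσ'
      exact (List.cons.inj h').2.symm
  refine (add_le_add_right h1 _).trans ?_
  rw [← Finset.sum_add_distrib]
  refine Finset.sum_le_sum fun τ hτ => ?_
  obtain ⟨K, L, rfl⟩ : ∃ K L, τ = K :: L :=
    List.exists_cons_of_length_eq_add_one (length_of_mem_witnessesOfDepth V hτ)
  have h2 : ∑ J ∈ nextLevels V (K :: L), ∏ a ∈ J, ψ a =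
      1 + ∑ J ∈ (nextLevels V (K :: L)).filter Finset.Nonempty, ∏ a ∈ J, ψ a := by
    rw [← Finset.sum_filter_add_sum_filter_not _ Finset.Nonempty, add_comm]
    congr 1
    have : (nextLevels V (K :: L)).filter (fun J => ¬J.Nonempty) = {∅} := by
      ext J
      simp only [Finset.mem_filter, Finset.not_nonempty_iff_eq_empty, Finset.mem_singleton,
        nextLevels]
      exact ⟨fun h => h.2, fun h => ⟨by simp [h], h⟩⟩
    rw [this]
    simp
  have h3 := sum_nextLevels_le h K L
  rw [h2] at h3
  simp only [headWeight, levelsWeight, List.head?_cons, Option.getD_some, List.tail_cons,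
    List.map_cons, List.prod_cons]
  rw [← Finset.sum_mul]
  calc _ = ((∏ a ∈ K, w a) * (1 + ∑ J ∈ (nextLevels V (K :: L)).filter Finset.Nonempty,
        ∏ a ∈ J, ψ a)) * (L.map fun J => ∏ a ∈ J, w a).prod := by ring
    _ ≤ _ := mul_le_mul_left h3 _

/-- The total weight of all witnesses of bounded depth. -/
theorem sum_levelsWeight_le (h : ∀ a, w a * ∏ b ∈ closedNbhd V a, (1 + ψ b) ≤ ψ a) (D : ℕ) :
    ∑ d ∈ Finset.range D, ∑ τ ∈ witnessesOfDepth V d, levelsWeight w τ ≤ ∑ a, ψ a := by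
  have key : ∀ D, ∑ d ∈ Finset.range D, ∑ τ ∈ witnessesOfDepth V d, levelsWeight w τ +
      ∑ τ ∈ witnessesOfDepth V D, headWeight w ψ τ ≤ ∑ a, ψ a := by
    intro D
    induction D with
    | zero =>
      rw [Finset.sum_range_zero, zero_add, witnessesOfDepth, Finset.sum_image fun a _ b _ hab => ?_]
      · simp [headWeight, levelsWeight]
      · simpa using hab
    | succ D ih =>
      refine le_trans ?_ ih
      rw [Finset.sum_range_succ, add_assoc]
      exact add_le_add_right (sum_headWeight_succ_le h D) _
  exact le_self_add.trans (key D)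

end Counting

/-! ### From witnesses to the number of resamplings -/

section Expectation

open scoped Classical

theorem logWitness_ne_nil {I : Type u} {α : Type w} (V : α → Set I) : ∀ {t : ℕ}
    {a : ℕ → Option α}, (∀ s ≤ t, a s ≠ none) → logWitness V a t ≠ []
  | 0, a, h => by
    obtain ⟨f, hf⟩ := Option.ne_none_iff_exists'.1 (h 0 le_rfl)
    simp [logWitness, hf]
  | t + 1, a, h => by
    obtain ⟨f, hf⟩ := Option.ne_none_iff_exists'.1 (h 0 (Nat.zero_le _))
    have h1 : logWitness V (fun s => a (s + 1)) t ≠ [] :=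
      logWitness_ne_nil V fun s hs => h (s + 1) (by omega)
    have h2 := (isWitness_logWitness V t fun s => a (s + 1)).resolve_left h1
    rw [logWitness, hf, Option.elim]
    exact (isWitness_insertEvent f h2).ne_nil

theorem levelsWeight_const_mul {α : Type w} (z : ℝ≥0∞) (c : α → ℝ≥0∞) (τ : List (Finset α)) :
    levelsWeight (fun a => z * c a) τ = z ^ levelsCard τ * levelsWeight c τ := by
  induction τ with
  | nil => simp [levelsWeight, levelsCard]
  | cons J τ ih =>
    simp only [levelsWeight, levelsCard, List.map_cons, List.prod_cons, List.sum_cons] at ih ⊢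
    rw [ih, Finset.prod_mul_distrib, Finset.prod_const, pow_add]
    ring

variable {I : Type u} {Ω : I → Type v} [∀ i, MeasurableSpace (Ω i)] {α : Type w}
  {A : α → Set (∀ i, Ω i)} {R : Type z} [MeasurableSpace R]

theorem mtResamplings_le_of_not_bad (σ : SelectionRule A R) {p : R × (ℕ → ∀ i, Ω i)} {m : ℕ}
    (h : ¬∃ a, mtState σ p.1 p.2 m ∈ A a) : (mtResamplings σ p : ℝ≥0∞) ≤ m := by
  have hsub : {t : ℕ | ∃ a, mtState σ p.1 p.2 t ∈ A a} ⊆ (Finset.range m : Set ℕ) := by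
    intro t ht
    rw [Finset.coe_range, Set.mem_Iio]
    by_contra hlt
    exact mtLog_eq_none.1 (mtLog_eq_none_mono (not_lt.1 hlt) (mtLog_eq_none.2 h)) ht
  have := Set.encard_le_encard hsub
  rw [Set.encard_coe_eq_coe_finsetCard, Finset.card_range] at this
  have h2 : ((mtResamplings σ p : ℕ∞) : ℝ≥0∞) ≤ ((m : ℕ∞) : ℝ≥0∞) := ENat.toENNReal_le.2 this
  simpa using h2

theorem mtResamplings_eq_tsum (σ : SelectionRule A R) (p : R × (ℕ → ∀ i, Ω i)) :
    (mtResamplings σ p : ℝ≥0∞) =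
      ∑' t, {p : R × (ℕ → ∀ i, Ω i) | ∃ a, mtState σ p.1 p.2 t ∈ A a}.indicator 1 p := by
  rw [mtResamplings, ← ENNReal.tsum_set_one]
  refine (tsum_subtype {t : ℕ | ∃ a, mtState σ p.1 p.2 t ∈ A a} (fun _ => (1 : ℝ≥0∞))).trans ?_
  refine tsum_congr fun t => ?_
  by_cases h : ∃ a, mtState σ p.1 p.2 t ∈ A a <;> simp [h]

variable [Fintype I]

/-- If the algorithm makes more than `m` resamplings, then one of them has a witness with at least
`m / n` events, where `n` is the number of variables. -/
theorem exists_levelsCard_logWitness_ge (hne : ∀ a, (A a).Nonempty → (vbl (A a)).Nonempty)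
    (σ : SelectionRule A R) (r : R) (y : ℕ → ∀ i, Ω i) {m k : ℕ} (hk : Fintype.card I * k ≤ m)
    (hm : mtLog σ r y m ≠ none) :
    ∃ t ≤ m, k + 1 ≤ levelsCard (logWitness (fun a => vbl (A a)) (mtLog σ r y) t) := by
  have hsome : ∀ s ≤ m, mtLog σ r y s ≠ none := fun s hs h => hm (mtLog_eq_none_mono hs h)
  obtain ⟨b, hb⟩ : ∃ b : ℕ → α, ∀ s ≤ m, mtLog σ r y s = some (b s) := by
    obtain ⟨a₀, _⟩ := Option.ne_none_iff_exists'.1 hm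
    refine ⟨fun s => (mtLog σ r y s).getD a₀, fun s hs => ?_⟩
    obtain ⟨a, ha⟩ := Option.ne_none_iff_exists'.1 (hsome s hs)
    simp [ha]
  have : Nonempty I := ⟨(hne (b 0) ⟨_, mtState_mem_of_mtLog (hb 0 (Nat.zero_le m))⟩).some⟩
  choose! v hv using fun s (hs : s ≤ m) => hne (b s) ⟨_, mtState_mem_of_mtLog (hb s hs)⟩
  -- Pigeonhole: rounds `0, …, m` number more than `n * k`, so one variable is chosen more than `k`
  -- times. The last round that involves it has the large witness.
  obtain ⟨i, -, hi⟩ := Finset.exists_lt_card_fiber_of_mul_lt_card_of_maps_to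
    (s := Finset.range (m + 1)) (t := (Finset.univ : Finset I)) (f := v) (n := k)
    (fun _ _ => Finset.mem_univ _) (by simpa using Nat.lt_succ_of_le hk)
  set F := (Finset.range (m + 1)).filter fun s => i ∈ vbl (A (b s)) with hF
  have hFcard : k < F.card := by
    refine hi.trans_le (Finset.card_le_card fun s hs => ?_)
    rw [Finset.mem_filter] at hs
    refine Finset.mem_filter.2 ⟨hs.1, ?_⟩
    rw [← hs.2]
    exact hv s (Nat.lt_succ_iff.1 (Finset.mem_range.1 hs.1))
  have hFne : F.Nonempty := Finset.card_pos.1 (Nat.zero_lt_of_lt hFcard)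
  have hmax := F.max'_mem hFne
  set t := F.max' hFne with ht
  rw [hF, Finset.mem_filter, Finset.mem_range] at hmax
  refine ⟨t, Nat.lt_succ_iff.1 hmax.1, ?_⟩
  refine le_trans ?_ (card_le_levelsCard_logWitness (fun a => vbl (A a)) i
    (fun s hs => hb s (hs.trans (Nat.lt_succ_iff.1 hmax.1))) hmax.2)
  refine (Nat.succ_le_of_lt hFcard).trans (Finset.card_le_card fun s hs => ?_)
  have hst : s ≤ t := F.le_max' s hs
  exact Finset.mem_filter.2 ⟨Finset.mem_range.2 (Nat.lt_succ_of_le hst),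
    (Finset.mem_filter.1 hs).2⟩

variable (μ : ∀ i, Measure (Ω i)) [∀ i, IsProbabilityMeasure (μ i)] [Fintype α]

/-- For `z = 1` this counts resamplings; `z > 1` gives an exponential moment of the witness sizes.
The factor `z ^ size` is absorbed by scaling every probability by `z`. -/
theorem lintegral_sum_pow_levelsCard_le (hA : ∀ a, MeasurableSet (A a))
    (hne : ∀ a, (A a).Nonempty → (vbl (A a)).Nonempty) (ρ : Measure R) [IsProbabilityMeasure ρ]
    (σ : SelectionRule A R) {z : ℝ≥0∞} {ψ : α → ℝ≥0∞}
    (hψ : ∀ a, z * Measure.pi μ (A a) * ∏ b ∈ closedNbhd (fun a => vbl (A a)) a, (1 + ψ b) ≤ ψ a)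
    (M : ℕ) :
    ∫⁻ p, ∑ t ∈ Finset.range M, (if mtLog σ p.1 p.2 t = none then 0 else
      z ^ levelsCard (logWitness (fun a => vbl (A a)) (mtLog σ p.1 p.2) t)) ∂(mtMeasure μ ρ) ≤
        ∑ a, ψ a := by
  set V : α → Set I := fun a => vbl (A a) with hV
  have hm : ∀ (t : ℕ) (τ : List (Finset α)), Measurable fun p : R × (ℕ → ∀ i, Ω i) =>
      (if logWitness V (mtLog σ p.1 p.2) t = τ then 1 else 0 : ℝ≥0∞) := fun t τ =>
    Measurable.ite (measurableSet_logWitness V t (measurableSet_mtLog hA σ) τ)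
      measurable_const measurable_const
  have hpt : ∀ p : R × (ℕ → ∀ i, Ω i), ∑ t ∈ Finset.range M,
      (if mtLog σ p.1 p.2 t = none then 0 else
        z ^ levelsCard (logWitness V (mtLog σ p.1 p.2) t)) ≤
      ∑ d ∈ Finset.range M, ∑ τ ∈ (witnessesOfDepth V d).filter (IsWitness V),
        z ^ levelsCard τ * ∑ t ∈ Finset.range M,
          (if logWitness V (mtLog σ p.1 p.2) t = τ then 1 else 0) := by
    intro p
    simp only [Finset.mul_sum]
    rw [Finset.sum_congr rfl fun d _ => Finset.sum_comm, Finset.sum_comm]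
    refine Finset.sum_le_sum fun t ht => ?_
    split_ifs with h
    · exact zero_le
    have hnil : logWitness V (mtLog σ p.1 p.2) t ≠ [] :=
      logWitness_ne_nil V fun s hs hn => h (mtLog_eq_none_mono hs hn)
    have hw := (isWitness_logWitness V t (mtLog σ p.1 p.2)).resolve_left hnil
    obtain ⟨d, hd⟩ := Nat.exists_eq_succ_of_ne_zero (mt List.length_eq_zero_iff.1 hnil)
    have hlen := length_logWitness_le V t (mtLog σ p.1 p.2)
    -- The witness of round `t` has at most `t + 1 ≤ M` levels, so finitely many depths suffice.
    have hdM : d ∈ Finset.range M := by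
      rw [Finset.mem_range] at ht ⊢
      omega
    refine le_trans ?_ (Finset.single_le_sum (fun _ _ => zero_le) hdM)
    refine le_trans ?_ (Finset.single_le_sum (fun _ _ => zero_le)
      (Finset.mem_filter.2 ⟨hw.mem_witnessesOfDepth V hd, hw⟩))
    simp
  refine (lintegral_mono hpt).trans ?_
  rw [lintegral_finsetSum _ fun d _ => Finset.measurable_fun_sum _ fun τ _ =>
    (Finset.measurable_fun_sum _ fun t _ => hm t τ).const_mul _]
  refine le_trans ?_ (sum_levelsWeight_le (V := V) (w := fun a => z * Measure.pi μ (A a)) hψ M)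
  refine Finset.sum_le_sum fun d _ => ?_
  rw [lintegral_finsetSum _ fun τ _ =>
    (Finset.measurable_fun_sum _ fun t _ => hm t τ).const_mul _]
  refine le_trans ?_ (Finset.sum_le_sum_of_subset (Finset.filter_subset (IsWitness V) _))
  refine Finset.sum_le_sum fun τ hτ => ?_
  rw [lintegral_const_mul _ (Finset.measurable_fun_sum _ fun t _ => hm t τ),
    levelsWeight_const_mul]
  exact mul_le_mul_right (lintegral_logWitness_le μ hA hne ρ σ M (Finset.mem_filter.1 hτ).2) _

theorem lintegral_mtResamplings_eq_tsum (hA : ∀ a, MeasurableSet (A a)) (ρ : Measure R)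
    [IsProbabilityMeasure ρ] (σ : SelectionRule A R) :
    ∫⁻ p, (mtResamplings σ p : ℝ≥0∞) ∂(mtMeasure μ ρ) =
      ∑' t, mtMeasure μ ρ {p | ∃ a, mtState σ p.1 p.2 t ∈ A a} := by
  simp only [mtResamplings_eq_tsum]
  rw [lintegral_tsum fun t =>
    (measurable_one.indicator (measurableSet_mtState_bad hA σ t)).aemeasurable]
  exact tsum_congr fun t => lintegral_indicator_one (measurableSet_mtState_bad hA σ t)

theorem lintegral_mtResamplings_le (hA : ∀ a, MeasurableSet (A a))
    (hne : ∀ a, (A a).Nonempty → (vbl (A a)).Nonempty) (ρ : Measure R) [IsProbabilityMeasure ρ]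
    (σ : SelectionRule A R) {ψ : α → ℝ≥0∞}
    (hψ : ∀ a, Measure.pi μ (A a) * ∏ b ∈ closedNbhd (fun a => vbl (A a)) a, (1 + ψ b) ≤ ψ a) :
    ∫⁻ p, (mtResamplings σ p : ℝ≥0∞) ∂(mtMeasure μ ρ) ≤ ∑ a, ψ a := by
  rw [lintegral_mtResamplings_eq_tsum μ hA]
  refine ENNReal.tsum_le_of_sum_range_le fun M => ?_
  refine le_trans (le_of_eq ?_)
    (lintegral_sum_pow_levelsCard_le μ hA hne ρ σ (z := 1) (by simpa using hψ) M)
  simp only [one_pow, mtLog_eq_none, ite_not]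
  rw [lintegral_finsetSum _ fun t _ => Measurable.ite (measurableSet_mtState_bad hA σ t)
    measurable_const measurable_const]
  refine Finset.sum_congr rfl fun t _ => ?_
  rw [← lintegral_indicator_one (measurableSet_mtState_bad hA σ t)]
  refine lintegral_congr fun p => ?_
  by_cases h : ∃ a, mtState σ p.1 p.2 t ∈ A a <;> simp [h]

theorem pow_mul_measure_mtState_bad_le (hA : ∀ a, MeasurableSet (A a))
    (hne : ∀ a, (A a).Nonempty → (vbl (A a)).Nonempty) (ρ : Measure R) [IsProbabilityMeasure ρ]
    (σ : SelectionRule A R) {z : ℝ≥0∞} (hz : 1 ≤ z) {ψ : α → ℝ≥0∞}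
    (hψ : ∀ a, z * Measure.pi μ (A a) * ∏ b ∈ closedNbhd (fun a => vbl (A a)) a, (1 + ψ b) ≤ ψ a)
    {m k : ℕ} (hk : Fintype.card I * k ≤ m) :
    z ^ (k + 1) * mtMeasure μ ρ {p | ∃ a, mtState σ p.1 p.2 m ∈ A a} ≤ ∑ a, ψ a := by
  refine le_trans ?_ (lintegral_sum_pow_levelsCard_le μ hA hne ρ σ hψ (m + 1))
  rw [← lintegral_indicator_const (measurableSet_mtState_bad hA σ m)]
  refine lintegral_mono fun p => ?_
  by_cases hp : p ∈ {p : R × (ℕ → ∀ i, Ω i) | ∃ a, mtState σ p.1 p.2 m ∈ A a}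
  · rw [Set.indicator_of_mem hp]
    have hm : mtLog σ p.1 p.2 m ≠ none := fun h => mtLog_eq_none.1 h hp
    obtain ⟨t, ht, hc⟩ := exists_levelsCard_logWitness_ge hne σ p.1 p.2 hk hm
    refine le_trans ?_ (Finset.single_le_sum (fun _ _ => zero_le)
      (Finset.mem_range.2 (Nat.lt_succ_of_le ht)))
    rw [if_neg fun h => hm (mtLog_eq_none_mono ht h)]
    exact pow_le_pow_right₀ hz hc
  · rw [Set.indicator_of_notMem hp]
    exact zero_le

end Expectation

/-! ### Using the local lemma condition -/

section LocalLemma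

open scoped Classical

variable {I : Type u} {Ω : I → Type v} {α : Type w} [Fintype α] {A : α → Set (∀ i, Ω i)}

theorem notMem_nbhd_self (a : α) : a ∉ nbhd A a := by
  simp [nbhd]

theorem closedNbhd_vbl (a : α) : closedNbhd (fun a => vbl (A a)) a = insert a (nbhd A a) := rfl

theorem lllWeight_le_self {x : α → ℝ} (hx : ∀ a, x a ∈ Set.Ioo (0 : ℝ) 1) (a : α) :
    lllWeight A x a ≤ x a :=
  mul_le_of_le_one_right (hx a).1.le
    (Finset.prod_le_one (fun b _ => by linarith [(hx b).2]) fun b _ => by linarith [(hx b).1])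

theorem lllWeight_pos {x : α → ℝ} (hx : ∀ a, x a ∈ Set.Ioo (0 : ℝ) 1) (a : α) :
    0 < lllWeight A x a :=
  mul_pos (hx a).1 (Finset.prod_pos fun b _ => by linarith [(hx b).2])

variable [∀ i, MeasurableSpace (Ω i)] [Fintype I] (μ : ∀ i, Measure (Ω i))
  [∀ i, IsProbabilityMeasure (μ i)]

/-- An event that depends on no variable is empty or certain. -/
theorem vbl_nonempty_of_measure_lt_one {B : Set (∀ i, Ω i)} (h : (Measure.pi μ).real B < 1)
    (hB : B.Nonempty) : (vbl B).Nonempty := by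
  by_contra hv
  rw [Set.not_nonempty_iff_eq_empty] at hv
  have hd := dependsOn_vbl B
  rw [hv] at hd
  obtain ⟨ω, hω⟩ := hB
  have huniv : B = Set.univ := Set.eq_univ_of_forall fun ω' => (hd fun i hi => hi.elim).mp hω
  rw [huniv] at h
  simp at h

/-- With `ψ = x / (1 - x)` one has `1 + ψ = 1 / (1 - x)`, so the product over the closed
neighbourhood cancels the one in `lllWeight` and leaves `1 / (1 - x a)`. -/
theorem mul_measure_mul_prod_closedNbhd_le {x : α → ℝ} (hx : ∀ a, x a ∈ Set.Ioo (0 : ℝ) 1)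
    {z : ℝ} (hz : 0 ≤ z) (h : ∀ a, z * (Measure.pi μ).real (A a) ≤ lllWeight A x a) (a : α) :
    ENNReal.ofReal z * Measure.pi μ (A a) * ∏ b ∈ closedNbhd (fun a => vbl (A a)) a,
      (1 + ENNReal.ofReal (x b / (1 - x b))) ≤ ENNReal.ofReal (x a / (1 - x a)) := by
  have h1 : ∀ b, 1 + ENNReal.ofReal (x b / (1 - x b)) = ENNReal.ofReal (1 - x b)⁻¹ := fun b => by
    have hb : 0 < 1 - x b := by linarith [(hx b).2]
    rw [← ENNReal.ofReal_one, ← ENNReal.ofReal_add zero_le_one (div_nonneg (hx b).1.le hb.le)]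
    congr 1
    field_simp
    ring
  have hpos : ∀ b, 0 < 1 - x b := fun b => by linarith [(hx b).2]
  simp only [h1]
  rw [← ENNReal.ofReal_prod_of_nonneg fun b _ => (inv_pos.2 (hpos b)).le,
    ← ofReal_measureReal (μ := Measure.pi μ) (s := A a), ← ENNReal.ofReal_mul hz,
    ← ENNReal.ofReal_mul (mul_nonneg hz measureReal_nonneg)]
  refine ENNReal.ofReal_le_ofReal ?_
  rw [closedNbhd_vbl, Finset.prod_insert (notMem_nbhd_self a), Finset.prod_inv_distrib]
  have hP : 0 < ∏ b ∈ nbhd A a, (1 - x b) := Finset.prod_pos fun b _ => hpos b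
  have h2 := h a
  rw [lllWeight] at h2
  calc z * (Measure.pi μ).real (A a) * ((1 - x a)⁻¹ * (∏ b ∈ nbhd A a, (1 - x b))⁻¹)
      ≤ (x a * ∏ b ∈ nbhd A a, (1 - x b)) * ((1 - x a)⁻¹ * (∏ b ∈ nbhd A a, (1 - x b))⁻¹) :=
        mul_le_mul_of_nonneg_right h2
          (mul_nonneg (inv_pos.2 (hpos a)).le (inv_pos.2 hP).le)
    _ = x a / (1 - x a) := by
        field_simp

variable {R : Type z} [MeasurableSpace R] {x : α → ℝ} {ε : ℝ}

theorem lintegral_mtResamplings_le_of_lll (hA : ∀ a, MeasurableSet (A a))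
    (hx : ∀ a, x a ∈ Set.Ioo (0 : ℝ) 1)
    (h : ∀ a, (Measure.pi μ).real (A a) ≤ lllWeight A x a)
    (ρ : Measure R) [IsProbabilityMeasure ρ] (σ : SelectionRule A R) :
    ∫⁻ p, (mtResamplings σ p : ℝ≥0∞) ∂(mtMeasure μ ρ) ≤
      ENNReal.ofReal (∑ a, x a / (1 - x a)) := by
  rw [ENNReal.ofReal_sum_of_nonneg fun a _ =>
    div_nonneg (hx a).1.le (by linarith [(hx a).2])]
  refine lintegral_mtResamplings_le μ hA (fun a => vbl_nonempty_of_measure_lt_one μ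
    ((h a).trans_lt ((lllWeight_le_self hx a).trans_lt (hx a).2))) ρ σ fun a => ?_
  have := mul_measure_mul_prod_closedNbhd_le μ hx zero_le_one (by simpa using h) a
  simpa using this

/-- With slack `ε` in the local lemma condition, the probability of more than `m` resamplings decays
exponentially in `ε m / n`. -/
theorem measure_mtState_bad_le (hA : ∀ a, MeasurableSet (A a)) (hε : ε ∈ Set.Ioo (0 : ℝ) 1)
    (hx : ∀ a, x a ∈ Set.Ioo (0 : ℝ) 1)
    (h : ∀ a, (Measure.pi μ).real (A a) ≤ (1 - ε) * lllWeight A x a)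
    (ρ : Measure R) [IsProbabilityMeasure ρ] (σ : SelectionRule A R) [Nonempty I] (m : ℕ) :
    mtMeasure μ ρ {p | ∃ a, mtState σ p.1 p.2 m ∈ A a} ≤
      ENNReal.ofReal (2 * (∑ a, x a) / ε * Real.exp (-((m + 1) * (ε / (2 * Fintype.card I))))) := by
  obtain ⟨hε0, hε1⟩ := hε
  -- Since `1 - ε ≤ (1 - e) ^ 2`, the slack splits in two: one factor `1 - e` shrinks the weights to
  -- `(1 - e) * x`, which keeps them away from `1`; the other becomes `z = (1 - e)⁻¹`.
  set e := ε / 2 with he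
  have he0 : 0 < e := by positivity
  have he1 : e < 1 := by rw [he]; linarith
  have h1e : 0 < 1 - e := by linarith
  have hx' : ∀ a, (1 - e) * x a ∈ Set.Ioo (0 : ℝ) 1 := fun a =>
    ⟨mul_pos h1e (hx a).1, by nlinarith [(hx a).1, (hx a).2]⟩
  have hlt : ∀ a, (Measure.pi μ).real (A a) < 1 := fun a => by
    refine (h a).trans_lt ?_
    nlinarith [lllWeight_le_self (A := A) hx a, lllWeight_pos (A := A) hx a, (hx a).2]
  have hcond : ∀ a, (1 - e)⁻¹ * (Measure.pi μ).real (A a) ≤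
      lllWeight A (fun a => (1 - e) * x a) a := by
    intro a
    rw [inv_mul_le_iff₀ h1e]
    have hprod : ∏ b ∈ nbhd A a, (1 - x b) ≤ ∏ b ∈ nbhd A a, (1 - (1 - e) * x b) :=
      Finset.prod_le_prod (fun b _ => by linarith [(hx b).2])
        fun b _ => by nlinarith [(hx b).1]
    have hw := lllWeight_pos (A := A) hx a
    calc (Measure.pi μ).real (A a) ≤ (1 - ε) * lllWeight A x a := h a
      _ ≤ ((1 - e) * (1 - e)) * lllWeight A x a :=
          mul_le_mul_of_nonneg_right (by rw [he]; nlinarith) hw.le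
      _ = (1 - e) * ((1 - e) * x a * ∏ b ∈ nbhd A a, (1 - x b)) := by rw [lllWeight]; ring
      _ ≤ (1 - e) * lllWeight A (fun a => (1 - e) * x a) a := by
          rw [lllWeight]
          exact mul_le_mul_of_nonneg_left (mul_le_mul_of_nonneg_left hprod (hx' a).1.le) h1e.le
  have hn : 0 < Fintype.card I := Fintype.card_pos
  set k := m / Fintype.card I with hk
  have hz1 : (1 : ℝ≥0∞) ≤ ENNReal.ofReal (1 - e)⁻¹ := by
    rw [← ENNReal.ofReal_one]
    exact ENNReal.ofReal_le_ofReal ((one_le_inv₀ h1e).2 (by linarith))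
  have hmain := pow_mul_measure_mtState_bad_le μ hA
    (fun a => vbl_nonempty_of_measure_lt_one μ (hlt a)) ρ σ hz1
    (mul_measure_mul_prod_closedNbhd_le μ hx' (inv_pos.2 h1e).le hcond)
    (Nat.mul_div_le m (Fintype.card I))
  rw [← hk, ← ENNReal.ofReal_sum_of_nonneg fun a _ =>
    div_nonneg (hx' a).1.le (by linarith [(hx' a).2]),
    ← ENNReal.ofReal_pow (inv_pos.2 h1e).le] at hmain
  have hpow : 0 < (1 - e)⁻¹ ^ (k + 1) := pow_pos (inv_pos.2 h1e) _
  rw [mul_comm, ← ENNReal.le_div_iff_mul_le (Or.inl (by simpa using hpow)) (Or.inl (by simp)),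
    ← ENNReal.ofReal_div_of_pos hpow] at hmain
  refine hmain.trans (ENNReal.ofReal_le_ofReal ?_)
  have hsum : ∑ a, (1 - e) * x a / (1 - (1 - e) * x a) ≤ 2 * (∑ a, x a) / ε := by
    rw [Finset.mul_sum, Finset.sum_div]
    refine Finset.sum_le_sum fun a _ => ?_
    have h3 : e ≤ 1 - (1 - e) * x a := by nlinarith [(hx a).2]
    have h4 : (1 - e) * x a ≤ x a := by nlinarith [(hx a).1]
    calc (1 - e) * x a / (1 - (1 - e) * x a) ≤ x a / e :=
          div_le_div₀ (hx a).1.le h4 he0 h3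
      _ = 2 * x a / ε := by rw [he]; field_simp
  have hexp : (1 - e) ^ (k + 1) ≤ Real.exp (-((m + 1) * (ε / (2 * Fintype.card I)))) := by
    have h5 : (1 - e) ^ (k + 1) ≤ Real.exp (-e) ^ (k + 1) :=
      pow_le_pow_left₀ h1e.le (by linarith [Real.add_one_le_exp (-e)]) _
    refine h5.trans ?_
    rw [← Real.exp_nat_mul, Real.exp_le_exp]
    have hmk : (m + 1 : ℝ) ≤ Fintype.card I * (k + 1) := by
      have : m + 1 ≤ Fintype.card I * (k + 1) := Nat.lt_mul_div_succ m hn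
      exact_mod_cast this
    have hn' : (0 : ℝ) < Fintype.card I := by exact_mod_cast hn
    have : (m + 1) * (ε / (2 * Fintype.card I)) ≤ (k + 1) * e := by
      calc (m + 1) * (ε / (2 * (Fintype.card I : ℝ)))
          ≤ (Fintype.card I * (k + 1)) * (ε / (2 * Fintype.card I)) :=
            mul_le_mul_of_nonneg_right hmk (by positivity)
        _ = (k + 1) * e := by rw [he]; field_simp
    push_cast
    linarith
  rw [inv_pow, div_inv_eq_mul]
  have hT : 0 ≤ 2 * (∑ a, x a) / ε :=
    div_nonneg (mul_nonneg zero_le_two (Finset.sum_nonneg fun a _ => (hx a).1.le)) hε0.le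
  exact mul_le_mul hsum hexp (pow_nonneg h1e.le _) hT

end LocalLemma

/-! ### The bound on `T` -/

section WeightBound

theorem one_sub_le_two_rpow_neg {t : ℝ} (ht : 0 ≤ t) : 1 - t ≤ (2 : ℝ) ^ (-t) := by
  rw [Real.rpow_def_of_pos two_pos]
  refine le_trans ?_ (Real.add_one_le_exp _)
  nlinarith [Real.log_two_lt_d9]

/-- The weights of pairwise adjacent bad events. -/
theorem le_two_rpow_neg_sum {α : Type*} [DecidableEq α] {s : Finset α} {x : α → ℝ}
    (hx : ∀ a, x a ∈ Set.Ioo (0 : ℝ) 1) {δ : ℝ} (hδ : δ ≤ 1 / 4)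
    (h : ∀ a ∈ s, δ ≤ x a * ∏ b ∈ s.erase a, (1 - x b)) : δ ≤ (2 : ℝ) ^ (-∑ a ∈ s, x a) := by
  have hquarter : ∀ {t : ℝ}, t ≤ 2 → (1 / 4 : ℝ) ≤ (2 : ℝ) ^ (-t) := fun {t} ht => by
    calc (1 / 4 : ℝ) = (2 : ℝ) ^ (-2 : ℝ) := by
          rw [Real.rpow_neg two_pos.le, Real.rpow_two]; norm_num
      _ ≤ (2 : ℝ) ^ (-t) := Real.rpow_le_rpow_of_exponent_le one_le_two (by linarith)
  by_cases hs : ∃ a ∈ s, ∃ b ∈ s, a ≠ b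
  -- With `x a ≤ x b`, `x a * (1 - x b) ≤ x b * (1 - x b) ≤ 1 / 4 ≤ 2 ^ (-(x a + x b))`; every other
  -- factor satisfies `1 - x c ≤ 2 ^ (-x c)`.
  · obtain ⟨a, b, ha, hb, hab, hle⟩ : ∃ a b, a ∈ s ∧ b ∈ s ∧ a ≠ b ∧ x a ≤ x b := by
      obtain ⟨a, ha, b, hb, hab⟩ := hs
      rcases le_total (x a) (x b) with h1 | h1
      · exact ⟨a, b, ha, hb, hab, h1⟩
      · exact ⟨b, a, hb, ha, hab.symm, h1⟩
    have hb' : b ∈ s.erase a := Finset.mem_erase.2 ⟨hab.symm, hb⟩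
    refine (h a ha).trans ?_
    rw [← Finset.mul_prod_erase _ _ hb', ← Finset.add_sum_erase _ _ ha,
      ← Finset.add_sum_erase _ _ hb', ← mul_assoc, ← add_assoc, neg_add,
      Real.rpow_add two_pos, ← Finset.sum_neg_distrib,
      Real.rpow_sum_of_pos two_pos]
    refine mul_le_mul ?_ (Finset.prod_le_prod (fun c _ => by linarith [(hx c).2])
      fun c _ => one_sub_le_two_rpow_neg (hx c).1.le)
      (Finset.prod_nonneg fun c _ => by linarith [(hx c).2]) (Real.rpow_nonneg two_pos.le _)
    refine le_trans ?_ (hquarter (by linarith [(hx a).2, (hx b).2]))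
    nlinarith [sq_nonneg (x b - 1 / 2), (hx b).2]
  -- At most one event is left, and here `δ ≤ 1 / 4` is needed.
  · push Not at hs
    refine hδ.trans (hquarter ?_)
    have hcard : s.card ≤ 1 := Finset.card_le_one.2 hs
    calc ∑ a ∈ s, x a ≤ ∑ _a ∈ s, (1 : ℝ) := Finset.sum_le_sum fun a _ => (hx a).2.le
      _ = s.card := by simp
      _ ≤ 2 := by exact_mod_cast hcard.trans one_le_two

open scoped Classical in
theorem sum_le_card_mul_logb {I : Type u} [Fintype I] {Ω : I → Type v} {α : Type w} [Fintype α]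
    [Nonempty α] {A : α → Set (∀ i, Ω i)} {x : α → ℝ} (hx : ∀ a, x a ∈ Set.Ioo (0 : ℝ) 1)
    (hv : ∀ a, (vbl (A a)).Nonempty) (hδ : lllDelta A x ≤ 1 / 4) :
    ∑ a, x a ≤ Fintype.card I * Real.logb 2 (1 / lllDelta A x) := by
  have hδ0 : 0 < lllDelta A x := (Finset.lt_inf'_iff _).2 fun a _ => lllWeight_pos hx a
  have hi : ∀ i : I, ∑ a ∈ Finset.univ.filter (fun a => i ∈ vbl (A a)), x a ≤
      Real.logb 2 (1 / lllDelta A x) := by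
    intro i
    have hclique : ∀ a ∈ Finset.univ.filter (fun a => i ∈ vbl (A a)), lllDelta A x ≤
        x a * ∏ b ∈ (Finset.univ.filter (fun a => i ∈ vbl (A a))).erase a, (1 - x b) := by
      intro a ha
      refine (Finset.inf'_le _ (Finset.mem_univ a)).trans
        (mul_le_mul_of_nonneg_left ?_ (hx a).1.le)
      refine Finset.prod_le_prod_of_subset_of_le_one ?_ (fun b _ => by linarith [(hx b).2])
        fun b _ _ => by linarith [(hx b).1]
      intro b hb
      simp only [Finset.mem_erase, Finset.mem_filter, Finset.mem_univ, true_and] at ha hb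
      simp only [nbhd, Finset.mem_filter, Finset.mem_univ, true_and]
      exact ⟨hb.1, i, hb.2, ha⟩
    have := le_two_rpow_neg_sum hx hδ hclique
    rw [one_div, Real.logb_inv, le_neg]
    exact (Real.logb_le_iff_le_rpow one_lt_two hδ0).2 this
  -- Each event is counted once for every variable it involves, hence at least once.
  calc ∑ a, x a ≤ ∑ a, ∑ i : I, if i ∈ vbl (A a) then x a else 0 := by
        refine Finset.sum_le_sum fun a _ => ?_
        obtain ⟨i, hi⟩ := hv a
        refine le_trans (by simp [hi]) (Finset.single_le_sum
          (f := fun i => if i ∈ vbl (A a) then x a else 0) (fun j _ => ?_) (Finset.mem_univ i))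
        split_ifs
        exacts [(hx a).1.le, le_rfl]
    _ = ∑ i : I, ∑ a ∈ Finset.univ.filter (fun a => i ∈ vbl (A a)), x a := by
        rw [Finset.sum_comm]
        simp only [Finset.sum_filter]
    _ ≤ ∑ _i : I, Real.logb 2 (1 / lllDelta A x) := Finset.sum_le_sum fun i _ => hi i
    _ = _ := by simp

end WeightBound

/-! ### Expectation and tail from exponential decay -/

section TailBounds

/-- Applied to `t = T / ε`, it moves the prefactor of the tail bound into the exponent. -/
theorem two_mul_le_exp_max_logb {t : ℝ} (ht : 0 < t) :
    2 * t ≤ Real.exp (2 * max 1 (Real.logb 2 t)) := by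
  set M := max 1 (Real.logb 2 t) with hM
  have h1 : 1 ≤ M := le_max_left _ _
  calc 2 * t = 2 * (2 : ℝ) ^ Real.logb 2 t := by
        rw [Real.rpow_logb two_pos (by norm_num) ht]
    _ ≤ 2 * (2 : ℝ) ^ M :=
        mul_le_mul_of_nonneg_left
          (Real.rpow_le_rpow_of_exponent_le one_le_two (le_max_right _ _)) two_pos.le
    _ ≤ Real.exp (2 * M) := by
        have h2 : (2 : ℝ) ≤ Real.exp M := by linarith [Real.add_one_le_exp M]
        have h3 : (2 : ℝ) ^ M ≤ Real.exp M := by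
          rw [Real.rpow_def_of_pos two_pos, Real.exp_le_exp]
          nlinarith [Real.log_two_lt_d9]
        rw [two_mul M, Real.exp_add]
        exact mul_le_mul h2 h3 (Real.rpow_nonneg two_pos.le _) (Real.exp_pos _).le

/-- A series of probabilities that decays exponentially with rate `c` after `2 M / c` terms. -/
theorem tsum_le_of_exp_decay {f : ℕ → ℝ≥0∞} {c M : ℝ} (hc : 0 < c) (hc1 : c ≤ 1) (hM : 0 ≤ M)
    (h1 : ∀ m, f m ≤ 1) (h : ∀ m : ℕ, f m ≤ ENNReal.ofReal (Real.exp (2 * M - (m + 1) * c))) :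
    ∑' m, f m ≤ ENNReal.ofReal (2 * M / c + 1 + 2 / c) := by
  -- Before `m₀` the trivial bound `1` is used; from there on the terms are dominated by a geometric
  -- series of ratio `exp (-c)`, whose sum is at most `2 / c` as `c ≤ 1`.
  set m₀ := ⌈2 * M / c⌉₊ with hm₀
  have hceil : 2 * M / c ≤ m₀ := Nat.le_ceil _
  have hceil' : (m₀ : ℝ) ≤ 2 * M / c + 1 := (Nat.ceil_lt_add_one (by positivity)).le
  have hr1 : Real.exp (-c) < 1 := by rw [Real.exp_lt_one_iff]; linarith
  have htail : ∑' m, f (m + m₀) ≤ ENNReal.ofReal (2 / c) := by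
    calc ∑' m, f (m + m₀) ≤ ∑' m : ℕ, ENNReal.ofReal (Real.exp (-c)) ^ m := by
          refine ENNReal.tsum_le_tsum fun m => (h _).trans ?_
          rw [← ENNReal.ofReal_pow (Real.exp_pos _).le, ← Real.exp_nat_mul]
          refine ENNReal.ofReal_le_ofReal (Real.exp_le_exp.2 ?_)
          rw [div_le_iff₀ hc] at hceil
          push_cast
          nlinarith
      _ = (1 - ENNReal.ofReal (Real.exp (-c)))⁻¹ := ENNReal.tsum_geometric _
      _ = ENNReal.ofReal (1 - Real.exp (-c))⁻¹ := by
          rw [← ENNReal.ofReal_one, ← ENNReal.ofReal_sub _ (Real.exp_pos _).le,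
            ENNReal.ofReal_inv_of_pos (by linarith)]
      _ ≤ ENNReal.ofReal (2 / c) := by
          refine ENNReal.ofReal_le_ofReal ?_
          rw [inv_le_comm₀ (by linarith) (by positivity), inv_div]
          have h2 : Real.exp (-c) ≤ (1 + c)⁻¹ := by
            rw [Real.exp_neg]
            exact inv_anti₀ (by linarith) (by linarith [Real.add_one_le_exp c])
          have h3 : (1 + c)⁻¹ ≤ 1 - c / 2 := by
            rw [inv_le_iff_one_le_mul₀ (by linarith)]
            nlinarith
          linarith
  have hhead : ∑ m ∈ Finset.range m₀, f m ≤ ENNReal.ofReal (2 * M / c + 1) := by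
    calc ∑ m ∈ Finset.range m₀, f m ≤ ∑ _m ∈ Finset.range m₀, 1 :=
          Finset.sum_le_sum fun m _ => h1 m
      _ = (m₀ : ℝ≥0∞) := by simp
      _ = ENNReal.ofReal m₀ := (ENNReal.ofReal_natCast _).symm
      _ ≤ _ := ENNReal.ofReal_le_ofReal hceil'
  rw [← Summable.sum_add_tsum_nat_add' (k := m₀) ENNReal.summable,
    ENNReal.ofReal_add (by positivity) (by positivity)]
  exact add_le_add hhead htail

variable {I : Type u} {Ω : I → Type v} [∀ i, MeasurableSpace (Ω i)] {α : Type w} [Fintype α]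
  {A : α → Set (∀ i, Ω i)} {R : Type z} [MeasurableSpace R]

theorem measurable_mtResamplings (hA : ∀ a, MeasurableSet (A a)) (σ : SelectionRule A R) :
    Measurable fun p : R × (ℕ → ∀ i, Ω i) => (mtResamplings σ p : ℝ≥0∞) := by
  simp only [mtResamplings_eq_tsum]
  exact Measurable.tsum fun t =>
    measurable_one.indicator (measurableSet_mtState_bad hA σ t)

variable [Fintype I] (μ : ∀ i, Measure (Ω i)) [∀ i, IsProbabilityMeasure (μ i)]

instance isProbabilityMeasure_mtMeasure (ρ : Measure R) [IsProbabilityMeasure ρ] :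
    IsProbabilityMeasure (mtMeasure μ ρ) :=
  inferInstanceAs (IsProbabilityMeasure (ρ.prod (Measure.infinitePi fun _ : ℕ => Measure.pi μ)))

/-- Markov's inequality for the number of resamplings. -/
theorem one_sub_one_div_le_measureReal_mtResamplings_le (hA : ∀ a, MeasurableSet (A a))
    (ρ : Measure R) [IsProbabilityMeasure ρ] (σ : SelectionRule A R) {v l : ℝ} (hv : 0 < v)
    (hl : 0 < l) (h : ∫⁻ p, (mtResamplings σ p : ℝ≥0∞) ∂(mtMeasure μ ρ) ≤ ENNReal.ofReal v) :
    1 - 1 / l ≤ (mtMeasure μ ρ).real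
      {p | (mtResamplings σ p : ℝ≥0∞) ≤ ENNReal.ofReal (l * v)} := by
  have hm := measurable_mtResamplings (Ω := Ω) hA σ
  have hS : MeasurableSet {p : R × (ℕ → ∀ i, Ω i) |
      (mtResamplings σ p : ℝ≥0∞) ≤ ENNReal.ofReal (l * v)} := hm measurableSet_Iic
  have hlv : 0 < l * v := mul_pos hl hv
  have hmarkov : mtMeasure μ ρ {p : R × (ℕ → ∀ i, Ω i) |
      (mtResamplings σ p : ℝ≥0∞) ≤ ENNReal.ofReal (l * v)}ᶜ ≤ ENNReal.ofReal (1 / l) := by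
    have hsub : {p : R × (ℕ → ∀ i, Ω i) | (mtResamplings σ p : ℝ≥0∞) ≤ ENNReal.ofReal (l * v)}ᶜ ⊆
        {p | ENNReal.ofReal (l * v) ≤ (mtResamplings σ p : ℝ≥0∞)} := by
      intro p hp
      simp only [Set.mem_compl_iff, Set.mem_ofPred_eq, not_le] at hp ⊢
      exact hp.le
    refine (measure_mono hsub).trans ?_
    have h1 := (mul_meas_ge_le_lintegral (μ := mtMeasure μ ρ) hm (ENNReal.ofReal (l * v))).trans h
    rw [mul_comm, ← ENNReal.le_div_iff_mul_le (Or.inl (by simpa using hlv)) (Or.inl (by simp)),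
      ← ENNReal.ofReal_div_of_pos hlv] at h1
    refine h1.trans (le_of_eq (congrArg _ ?_))
    field_simp
  have h2 : (mtMeasure μ ρ).real {p : R × (ℕ → ∀ i, Ω i) |
      (mtResamplings σ p : ℝ≥0∞) ≤ ENNReal.ofReal (l * v)}ᶜ ≤ 1 / l :=
    ENNReal.toReal_le_of_le_ofReal (by positivity) hmarkov
  rw [probReal_compl_eq_one_sub hS] at h2
  linarith

theorem one_sub_le_measureReal_mtResamplings_le (hA : ∀ a, MeasurableSet (A a))
    (ρ : Measure R) [IsProbabilityMeasure ρ] (σ : SelectionRule A R) {s q : ℝ} (hs : 0 ≤ s)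
    (hq : 0 ≤ q)
    (h : mtMeasure μ ρ {p | ∃ a, mtState σ p.1 p.2 ⌊s⌋₊ ∈ A a} ≤ ENNReal.ofReal q) :
    1 - q ≤ (mtMeasure μ ρ).real {p | (mtResamplings σ p : ℝ≥0∞) ≤ ENNReal.ofReal s} := by
  have hB := measurableSet_mtState_bad (Ω := Ω) hA σ ⌊s⌋₊
  have h1 : (mtMeasure μ ρ).real {p | ∃ a, mtState σ p.1 p.2 ⌊s⌋₊ ∈ A a} ≤ q :=
    ENNReal.toReal_le_of_le_ofReal hq h
  have h2 := probReal_compl_eq_one_sub (μ := mtMeasure μ ρ) hB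
  have h3 : (mtMeasure μ ρ).real {p | ∃ a, mtState σ p.1 p.2 ⌊s⌋₊ ∈ A a}ᶜ ≤
      (mtMeasure μ ρ).real {p | (mtResamplings σ p : ℝ≥0∞) ≤ ENNReal.ofReal s} := by
    refine measureReal_mono fun p hp => (mtResamplings_le_of_not_bad σ hp).trans ?_
    rw [← ENNReal.ofReal_natCast]
    exact ENNReal.ofReal_le_ofReal (Nat.floor_le hs)
  linarith

end TailBounds

/-! ### The main theorem -/

theorem theorem3p1 :
    ∃ K : ℝ, 0 < K ∧
      ∀ (I : Type u) [Fintype I] (Ω : I → Type v) [∀ i, MeasurableSpace (Ω i)]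
        (μ : ∀ i, Measure (Ω i)) [∀ i, IsProbabilityMeasure (μ i)]
        (α : Type w) [Fintype α] [Nonempty α]
        (A : α → Set (∀ i, Ω i)) (_ : ∀ a, MeasurableSet (A a))
        (ε : ℝ) (_ : ε ∈ Set.Ico (0 : ℝ) 1)
        (x : α → ℝ) (_ : ∀ a, x a ∈ Set.Ioo (0 : ℝ) 1)
        (_ : ∀ a, (Measure.pi μ).real (A a) ≤ (1 - ε) * lllWeight A x a),
        -- the bound on `T`
        ((∀ a, (vbl (A a)).Nonempty) → lllDelta A x ≤ 1 / 4 →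
          ∑ a, x a ≤ Fintype.card I * Real.logb 2 (1 / lllDelta A x)) ∧
        -- the number of resamplings, for every selection rule
        ∀ (R : Type z) [MeasurableSpace R] (ρ : Measure R) [IsProbabilityMeasure ρ]
          (σ : SelectionRule A R),
          (ε = 0 →
            ∀ v₁ : ℝ,
              v₁ = (∑ a, x a) * Finset.univ.sup' Finset.univ_nonempty (fun a => 1 / (1 - x a)) →
              ∫⁻ p, (mtResamplings σ p : ℝ≥0∞) ∂(mtMeasure μ ρ) ≤ ENNReal.ofReal v₁ ∧
              ∀ l : ℝ, 1 ≤ l →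
                1 - 1 / l ≤ (mtMeasure μ ρ).real
                  {p | (mtResamplings σ p : ℝ≥0∞) ≤ ENNReal.ofReal (l * v₁)}) ∧
          (0 < ε →
            ∀ v₂ : ℝ,
              v₂ = K * (Fintype.card I / ε * max 1 (Real.logb 2 ((∑ a, x a) / ε))) →
              ∫⁻ p, (mtResamplings σ p : ℝ≥0∞) ∂(mtMeasure μ ρ) ≤ ENNReal.ofReal v₂ ∧
              ∀ l : ℝ, 1 ≤ l →
                1 - Real.exp (-l) ≤ (mtMeasure μ ρ).real
                  {p | (mtResamplings σ p : ℝ≥0∞) ≤ ENNReal.ofReal (l * v₂)}) := by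
  refine ⟨12, by norm_num, ?_⟩
  intro I _ Ω _ μ _ α _ _ A hA ε hε x hx h
  refine ⟨fun hv hδ => sum_le_card_mul_logb hx hv hδ, ?_⟩
  intro R _ ρ _ σ
  have hT : 0 < ∑ a, x a := Finset.sum_pos (fun a _ => (hx a).1) Finset.univ_nonempty
  refine ⟨?_, ?_⟩
  · rintro hε0 v₁ hv₁
    have hle : ∀ a, 1 / (1 - x a) ≤
        Finset.univ.sup' Finset.univ_nonempty fun a => 1 / (1 - x a) := fun a =>
      Finset.le_sup' (fun a => 1 / (1 - x a)) (Finset.mem_univ a)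
    have hmax : 0 < Finset.univ.sup' Finset.univ_nonempty fun a => 1 / (1 - x a) := by
      obtain ⟨a⟩ := (inferInstance : Nonempty α)
      exact (one_div_pos.2 (by linarith [(hx a).2])).trans_le (hle a)
    have hexp : ∫⁻ p, (mtResamplings σ p : ℝ≥0∞) ∂(mtMeasure μ ρ) ≤ ENNReal.ofReal v₁ := by
      refine (lintegral_mtResamplings_le_of_lll μ hA hx
        (fun a => by simpa [hε0] using h a) ρ σ).trans (ENNReal.ofReal_le_ofReal ?_)
      rw [hv₁, Finset.sum_mul]
      refine Finset.sum_le_sum fun a _ => ?_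
      rw [div_eq_mul_one_div]
      exact mul_le_mul_of_nonneg_left (hle a) (hx a).1.le
    exact ⟨hexp, fun l hl => one_sub_one_div_le_measureReal_mtResamplings_le μ hA ρ σ
      (by rw [hv₁]; exact mul_pos hT hmax) (by linarith) hexp⟩
  · rintro hε0 v₂ hv₂
    set M := max 1 (Real.logb 2 ((∑ a, x a) / ε)) with hM
    have hM1 : 1 ≤ M := le_max_left _ _
    have hv₂0 : 0 ≤ v₂ := by rw [hv₂]; positivity
    cases isEmpty_or_nonempty I with
    -- Without variables `v₂ = 0`, so there must be no resampling at all: events of probability less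
    -- than `1` are then empty.
    | inl hI =>
      have hlt : ∀ a, (Measure.pi μ).real (A a) < 1 := fun a => by
        refine (h a).trans_lt ?_
        nlinarith [lllWeight_le_self (A := A) hx a, lllWeight_pos (A := A) hx a, (hx a).2]
      have hN : ∀ p, (mtResamplings σ p : ℝ≥0∞) = 0 := fun p => by
        have : ¬∃ a, mtState σ p.1 p.2 0 ∈ A a := by
          rintro ⟨a, ha⟩
          exact isEmptyElim (vbl_nonempty_of_measure_lt_one μ (hlt a) ⟨_, ha⟩).some
        simpa using mtResamplings_le_of_not_bad σ this
      simp [hN, Real.exp_nonneg]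
    | inr hI =>
      have hn : (1 : ℝ) ≤ Fintype.card I := by exact_mod_cast (Fintype.card_pos : 0 < _)
      set c := ε / (2 * Fintype.card I) with hc
      have hc0 : 0 < c := by positivity
      have hc1 : c ≤ 1 := by
        rw [hc, div_le_one (by positivity)]
        linarith [hε.2]
      -- The choice `K = 12` makes `v₂ = 6 M / c`. This exceeds the bound `2 M / c + 1 + 2 / c` on
      -- the expectation because `M ≥ 1` and `c ≤ 1`.
      have hv₂c : v₂ * c = 6 * M := by
        rw [hv₂, hc]
        field_simp
        norm_num
      have htail : ∀ m : ℕ, mtMeasure μ ρ {p | ∃ a, mtState σ p.1 p.2 m ∈ A a} ≤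
          ENNReal.ofReal (Real.exp (2 * M - (m + 1) * c)) := by
        intro m
        refine (measure_mtState_bad_le μ hA ⟨hε0, hε.2⟩ hx h ρ σ m).trans
          (ENNReal.ofReal_le_ofReal ?_)
        rw [sub_eq_add_neg, Real.exp_add, mul_div_assoc]
        exact mul_le_mul_of_nonneg_right (two_mul_le_exp_max_logb (div_pos hT hε0))
          (Real.exp_pos _).le
      refine ⟨?_, fun l hl => ?_⟩
      · rw [lintegral_mtResamplings_eq_tsum μ hA]
        refine (tsum_le_of_exp_decay hc0 hc1 (by linarith) (fun m => prob_le_one) htail).trans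
          (ENNReal.ofReal_le_ofReal ?_)
        have : v₂ = 6 * M / c := by rw [← hv₂c]; field_simp
        rw [this, div_add_one hc0.ne', ← add_div]
        exact div_le_div_of_nonneg_right (by linarith) hc0.le
      · refine one_sub_le_measureReal_mtResamplings_le μ hA ρ σ
          (mul_nonneg (by linarith) hv₂0) (Real.exp_pos _).le ((htail _).trans
            (ENNReal.ofReal_le_ofReal (Real.exp_le_exp.2 ?_)))
        have hfl : l * v₂ ≤ ⌊l * v₂⌋₊ + 1 := (Nat.lt_floor_add_one _).le
        -- The exponent is then at most `2 M - 6 M l ≤ -4 M l ≤ -l`, using `l ≥ 1` and `M ≥ 1`.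
        have : l * (6 * M) ≤ (⌊l * v₂⌋₊ + 1) * c := by
          rw [← hv₂c, ← mul_assoc]
          exact mul_le_mul_of_nonneg_right hfl hc0.le
        nlinarith
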